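/- Let $A=\{\mathbf a_1,\dots,\mathbf a_N\}\subset\mathbb Z^r$ be a set of $N>r$ distinct vectors whose $\mathbb Z$-span is $\mathbb Z^r$ and for which there is a linear form $h$ with $h(\mathbf a_j)=1$ for all $j$. Put $d=N-r$, let $L=\{l\in\mathbb Z^N: \sum_j l_j\mathbf a_j=0\}$, let $B$ be a $d\times N$ matrix whose rows form a $\mathbb Z$-basis of $L$, and let $\mathbf b_1,\dots,\mathbf b_N\in\mathbb Z^d$ be its columns. Let $\alpha\in\mathbb R^r$, and let $H_A(\alpha)$ be the system of differential equations $$\sum_{j=1}^N a_{ij}v_j\frac{\partial\Phi}{\partial v_j}=\alpha_i\Phi\quad(1\le i\le r),\qquad \prod_{l_j>0}\Big(\frac{\partial}{\partial v_j}\Big)^{l_j}\Phi=\prod_{l_j<0}\Big(\frac{\partial}{\partial v_j}\Big)^{-l_j}\Phi\quad(l\in L),$$ where $a_{ij}$ is the $i$-th coordinate of $\mathbf a_j$. Assume that $H_A(\alpha)$ is totally non-resonant, i.e. that $\alpha+\mathbb Z^r$ does not meet any hyperplane spanned by $r-1$ linearly independent elements of $A$. Assume that $H_A(\alpha)$ has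 rank $D$, i.e. that around a generic point (every point of a dense open subset of $\mathbb C^N$) the space of germs of holomorphic solutions has dimension $D$ over $\mathbb C$. Let $\gamma_1,\dots,\gamma_N$ be negative real numbers with $\sum_j\gamma_j\mathbf a_j=\alpha$ (in particular, such numbers are assumed to exist). For $\upsilon\in(\mathbb C^*)^N$, a determination around $\upsilon$ of the Mellin–Barnes integral is the germ at $\upsilon$ of the function $$M(v)=\int_{\sqrt{-1}\,\mathbb R^d}\prod_{j=1}^N\Gamma(-\gamma_j-\mathbf b_j\cdot\mathbf s)\,v_j^{\gamma_j+\mathbf b_j\cdot\mathbf s}\,d\mathbf s ,$$ where $\theta_1,\dots,\theta_N\in\mathbb R$ are arguments of $\upsilon_1,\dots,\upsilon_N$, the powers of $v_j$ are defined by the branch of $\log v_j$ that is continuous near $\upsilon_j$ with value $\log|\upsilon_j|+\sqrt{-1}\,\theta_j$ at $\upsilon_j$, and the integral converges absolutely for all $v$ in a neighbourhood of $\upsilon$. The system has a Mellin–Barnes basis of solutions if there is a point $\upsilon\in(\mathbb C^*)^N$ such that the space of germs at $\upsilon$ of holomorphic solutions of $H_A(\alpha)$ has a basis of $D$ elements,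 each of which is a determination around $\upsilon$ of the Mellin–Barnes integral. Let $$Z_B=\Big\{\tfrac14\sum_{j=1}^N\mu_j\mathbf b_j : -1<\mu_j<1\Big\}\subset\mathbb R^d .$$ Then $H_A(\alpha)$ has a Mellin–Barnes basis of solutions if and only if $Z_B$ contains $D$ distinct points $\tau_1,\dots,\tau_D$ all of whose differences $\tau_i-\tau_j$ lie in $\mathbb Z^d$. -/

import Mathlib

open Filter Topology MeasureTheory

noncomputable section

namespace AHypergeometric

/-! ### The system `H_A(α)` -/

/-- The real vector attached to an integer vector. -/
def toReal {r : ℕ} (x : Fin r → ℤ) : Fin r → ℝ := fun i => (x i : ℝ)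

/-- `A = {a 1, …, a N} ⊂ ℤ^r` is a set of `N` elements that spans `ℤ^r` over `ℤ` and lies in
a hyperplane `h = 1` for some linear form `h`. -/
structure IsASet {r N : ℕ} (a : Fin N → Fin r → ℤ) : Prop where
  injective : Function.Injective a
  span_eq_top : Submodule.span ℤ (Set.range a) = ⊤
  exists_form : ∃ h : (Fin r → ℝ) →ₗ[ℝ] ℝ, ∀ j, h (toReal (a j)) = 1

/-- The lattice `L` of integer relations between the `a j`. -/
def relationLattice {r N : ℕ} (a : Fin N → Fin r → ℤ) : Submodule ℤ (Fin N → ℤ) where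
  carrier := {l | ∑ j, l j • a j = 0}
  add_mem' := by
    intro l m hl hm
    simp only [Set.mem_ofPred_eq, Pi.add_apply, add_smul, Finset.sum_add_distrib] at *
    rw [hl, hm, add_zero]
  zero_mem' := by simp
  smul_mem' := by
    intro c l hl
    simp only [Set.mem_ofPred_eq, Pi.smul_apply, smul_assoc] at *
    rw [← Finset.smul_sum, hl, smul_zero]

/-- `α + ℤ^r` meets no hyperplane spanned by `r - 1` independent elements of `A`. -/
def TotallyNonResonant {r N : ℕ} (a : Fin N → Fin r → ℤ) (α : Fin r → ℝ) : Prop :=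
  ∀ S : Finset (Fin N), S.card + 1 = r →
    LinearIndependent ℝ (fun j : S => toReal (a j)) →
    ∀ z : Fin r → ℤ, α + toReal z ∉ Submodule.span ℝ (Set.range fun j : S => toReal (a j))

/-- The partial derivative `∂_j Φ`. -/
def pderiv {N : ℕ} (j : Fin N) (Φ : (Fin N → ℂ) → ℂ) : (Fin N → ℂ) → ℂ :=
  fun v => fderiv ℂ Φ v (Pi.single j 1)

/-- `∂_1^{k 1} ⋯ ∂_N^{k N} Φ`. -/
def pderivPow {N : ℕ} (k : Fin N → ℕ) (Φ : (Fin N → ℂ) → ℂ) : (Fin N → ℂ) → ℂ :=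
  (List.finRange N).foldr (fun j Ψ => (pderiv j)^[k j] Ψ) Φ

/-- `Φ` is holomorphic around `v` and the equations of `H_A(α)` hold for `Φ` at the point `v`:
`(Z_i - α_i) Φ = 0` for all `i` and `□_l Φ = 0` for all `l ∈ L`. -/
structure SolvesAt {r N : ℕ} (a : Fin N → Fin r → ℤ) (α : Fin r → ℝ)
    (Φ : (Fin N → ℂ) → ℂ) (v : Fin N → ℂ) : Prop where
  analyticAt : AnalyticAt ℂ Φ v
  euler : ∀ i, ∑ j, (a j i : ℂ) * v j * pderiv j Φ v - (α i : ℂ) * Φ v = 0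
  box : ∀ l ∈ relationLattice a,
    pderivPow (fun j => (l j).toNat) Φ v - pderivPow (fun j => (-l j).toNat) Φ v = 0

section linearity

variable {N : ℕ} {Φ Ψ : (Fin N → ℂ) → ℂ} {v : Fin N → ℂ}

theorem analyticAt_pderiv (j : Fin N) (h : AnalyticAt ℂ Φ v) : AnalyticAt ℂ (pderiv j Φ) v :=
  ((ContinuousLinearMap.apply ℂ ℂ (Pi.single j (1 : ℂ) : Fin N → ℂ)).analyticAt _).comp
    h.fderiv

theorem pderiv_congr (j : Fin N) (h : Φ =ᶠ[𝓝 v] Ψ) : pderiv j Φ =ᶠ[𝓝 v] pderiv j Ψ := by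
  filter_upwards [h.fderiv (𝕜 := ℂ)] with w hw
  simp [pderiv, hw]

theorem pderiv_add (j : Fin N) (hΦ : AnalyticAt ℂ Φ v) (hΨ : AnalyticAt ℂ Ψ v) :
    pderiv j (Φ + Ψ) =ᶠ[𝓝 v] pderiv j Φ + pderiv j Ψ := by
  filter_upwards [hΦ.eventually_analyticAt, hΨ.eventually_analyticAt] with w h1 h2
  simp [pderiv, fderiv_add h1.differentiableAt h2.differentiableAt]

theorem pderiv_smul (j : Fin N) (c : ℂ) (hΦ : AnalyticAt ℂ Φ v) :
    pderiv j (c • Φ) =ᶠ[𝓝 v] c • pderiv j Φ := by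
  filter_upwards [hΦ.eventually_analyticAt] with w h1
  simp [pderiv, fderiv_const_smul h1.differentiableAt]

/-- An operator on functions that acts linearly on germs of holomorphic functions at `v`. -/
structure GermLinear (v : Fin N → ℂ) (T : ((Fin N → ℂ) → ℂ) → ((Fin N → ℂ) → ℂ)) : Prop where
  analyticAt : ∀ {Φ}, AnalyticAt ℂ Φ v → AnalyticAt ℂ (T Φ) v
  congr : ∀ {Φ Ψ}, Φ =ᶠ[𝓝 v] Ψ → T Φ =ᶠ[𝓝 v] T Ψ
  add : ∀ {Φ Ψ}, AnalyticAt ℂ Φ v → AnalyticAt ℂ Ψ v → T (Φ + Ψ) =ᶠ[𝓝 v] T Φ + T Ψ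
  smul : ∀ {Φ} (c : ℂ), AnalyticAt ℂ Φ v → T (c • Φ) =ᶠ[𝓝 v] c • T Φ

theorem germLinear_pderiv (j : Fin N) : GermLinear v (pderiv j) :=
  ⟨analyticAt_pderiv j, pderiv_congr j, pderiv_add j, fun c => pderiv_smul j c⟩

theorem germLinear_id : GermLinear v (fun Φ => Φ) :=
  ⟨fun h => h, fun h => h, fun _ _ => EventuallyEq.rfl, fun _ _ => EventuallyEq.rfl⟩

theorem GermLinear.comp {S T : ((Fin N → ℂ) → ℂ) → ((Fin N → ℂ) → ℂ)}
    (hS : GermLinear v S) (hT : GermLinear v T) : GermLinear v (fun Φ => S (T Φ)) :=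
  ⟨fun h => hS.analyticAt (hT.analyticAt h), fun h => hS.congr (hT.congr h),
    fun h1 h2 => (hS.congr (hT.add h1 h2)).trans (hS.add (hT.analyticAt h1) (hT.analyticAt h2)),
    fun c h => (hS.congr (hT.smul c h)).trans (hS.smul c (hT.analyticAt h))⟩

theorem GermLinear.iterate {T : ((Fin N → ℂ) → ℂ) → ((Fin N → ℂ) → ℂ)}
    (hT : GermLinear v T) (n : ℕ) : GermLinear v (T^[n]) := by
  induction n with
  | zero => exact germLinear_id
  | succ n ih => exact ih.comp hT

theorem germLinear_pderivPow (k : Fin N → ℕ) : GermLinear v (pderivPow k) := by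
  unfold pderivPow
  induction List.finRange N with
  | nil => exact germLinear_id
  | cons j t ih => exact ((germLinear_pderiv j).iterate (k j)).comp ih

theorem solvesAt_add {r : ℕ} {a : Fin N → Fin r → ℤ} {α : Fin r → ℝ}
    (hΦ : SolvesAt a α Φ v) (hΨ : SolvesAt a α Ψ v) : SolvesAt a α (Φ + Ψ) v where
  analyticAt := hΦ.analyticAt.add hΨ.analyticAt
  euler i := by
    have h1 := hΦ.euler i
    have h2 := hΨ.euler i
    have h3 : ∀ j, pderiv j (Φ + Ψ) v = pderiv j Φ v + pderiv j Ψ v := fun j =>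
      ((germLinear_pderiv j).add hΦ.analyticAt hΨ.analyticAt).eq_of_nhds
    simp only [h3, mul_add, Finset.sum_add_distrib, Pi.add_apply]
    linear_combination h1 + h2
  box l hl := by
    have h1 := hΦ.box l hl
    have h2 := hΨ.box l hl
    rw [((germLinear_pderivPow _).add hΦ.analyticAt hΨ.analyticAt).eq_of_nhds,
      ((germLinear_pderivPow _).add hΦ.analyticAt hΨ.analyticAt).eq_of_nhds]
    simp only [Pi.add_apply]
    linear_combination h1 + h2

theorem solvesAt_smul {r : ℕ} {a : Fin N → Fin r → ℤ} {α : Fin r → ℝ} (c : ℂ)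
    (hΦ : SolvesAt a α Φ v) : SolvesAt a α (c • Φ) v where
  analyticAt := hΦ.analyticAt.const_smul
  euler i := by
    have h1 := hΦ.euler i
    have h3 : ∀ j, pderiv j (c • Φ) v = c * pderiv j Φ v := fun j =>
      ((germLinear_pderiv j).smul c hΦ.analyticAt).eq_of_nhds
    simp only [h3, Pi.smul_apply, smul_eq_mul, mul_left_comm _ c, ← Finset.mul_sum, ← mul_sub, h1,
      mul_zero]
  box l hl := by
    have h1 := hΦ.box l hl
    rw [((germLinear_pderivPow _).smul c hΦ.analyticAt).eq_of_nhds,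
      ((germLinear_pderivPow _).smul c hΦ.analyticAt).eq_of_nhds]
    simp only [Pi.smul_apply, smul_eq_mul, ← mul_sub, h1, mul_zero]

theorem solvesAt_zero {r : ℕ} {a : Fin N → Fin r → ℤ} {α : Fin r → ℝ} :
    SolvesAt a α (0 : (Fin N → ℂ) → ℂ) v := by
  have h0 : ∀ k : Fin N → ℕ, pderivPow k (0 : (Fin N → ℂ) → ℂ) v = 0 := fun k => by
    have := ((germLinear_pderivPow (v := v) k).smul (0 : ℂ)
      (Φ := (0 : (Fin N → ℂ) → ℂ)) analyticAt_const).eq_of_nhds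
    simpa using this
  exact ⟨analyticAt_const, fun i => by simp [pderiv], fun l _ => by rw [h0, h0, sub_zero]⟩

end linearity

/-- The space of local solutions of `H_A(α)` around `υ`: germs at `υ` of holomorphic functions
that satisfy the equations in a neighbourhood of `υ`. -/
def localSolutions {r N : ℕ} (a : Fin N → Fin r → ℤ) (α : Fin r → ℝ) (υ : Fin N → ℂ) :
    Submodule ℂ (Germ (𝓝 υ) ℂ) where
  carrier := {g | ∃ Φ : (Fin N → ℂ) → ℂ, (Φ : Germ (𝓝 υ) ℂ) = g ∧ ∀ᶠ v in 𝓝 υ, SolvesAt a α Φ v}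
  add_mem' := by
    rintro _ _ ⟨Φ, rfl, hΦ⟩ ⟨Ψ, rfl, hΨ⟩
    exact ⟨Φ + Ψ, rfl, by filter_upwards [hΦ, hΨ] with v h1 h2 using solvesAt_add h1 h2⟩
  zero_mem' := ⟨0, rfl, Eventually.of_forall fun _ => solvesAt_zero⟩
  smul_mem' := by
    rintro c _ ⟨Φ, rfl, hΦ⟩
    exact ⟨c • Φ, rfl, by filter_upwards [hΦ] with v h1 using solvesAt_smul c h1⟩

/-- `H_A(α)` has rank `D`: around every point of some dense open set, i.e. around a generic
point, the space of local solutions has dimension `D`. -/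
def HasRank {r N : ℕ} (a : Fin N → Fin r → ℤ) (α : Fin r → ℝ) (D : ℕ) : Prop :=
  ∃ U : Set (Fin N → ℂ), IsOpen U ∧ Dense U ∧
    ∀ υ ∈ U, Module.rank ℂ (localSolutions a α υ) = (D : Cardinal)

/-! ### Mellin–Barnes integrals -/

/-- `B` is a B-matrix: its rows form a `ℤ`-basis of `L`. -/
def IsBMatrix {r N d : ℕ} (a : Fin N → Fin r → ℤ) (B : Matrix (Fin d) (Fin N) ℤ) : Prop :=
  LinearIndependent ℤ (fun k : Fin d => B k) ∧
    Submodule.span ℤ (Set.range fun k : Fin d => B k) = relationLattice a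

/-- The form `b_j · s`, where `b_j` is the `j`-th column of `B`. -/
def columnForm {N d : ℕ} (B : Matrix (Fin d) (Fin N) ℤ) (j : Fin N) (s : Fin d → ℂ) : ℂ :=
  ∑ k, (B k j : ℂ) * s k

/-- The branch of the logarithm around the ray of argument `θ` whose imaginary part is `θ`
on that ray. -/
def branchLog (θ : ℝ) (z : ℂ) : ℂ :=
  Complex.log (z * Complex.exp (-(θ * Complex.I))) + θ * Complex.I

/-- `∏ Γ(-γ_j - b_j · s) v_j ^ (γ_j + b_j · s)`, where the powers are taken with the branches of
the logarithm given by `θ`. -/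
def mbIntegrand {N d : ℕ} (γ : Fin N → ℝ) (B : Matrix (Fin d) (Fin N) ℤ) (θ : Fin N → ℝ)
    (v : Fin N → ℂ) (s : Fin d → ℂ) : ℂ :=
  ∏ j, Complex.Gamma (-(γ j : ℂ) - columnForm B j s) *
    Complex.exp (((γ j : ℂ) + columnForm B j s) * branchLog (θ j) (v j))

/-- The point `√-1 t` of `√-1 ℝ^d`. -/
def imagPoint {d : ℕ} (t : Fin d → ℝ) : Fin d → ℂ := fun k => Complex.I * (t k : ℂ)

/-- Absolute convergence of the Mellin–Barnes integral. -/
def MBConverges {N d : ℕ} (γ : Fin N → ℝ) (B : Matrix (Fin d) (Fin N) ℤ) (θ : Fin N → ℝ)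
    (v : Fin N → ℂ) : Prop :=
  Integrable (fun t : Fin d → ℝ => mbIntegrand γ B θ v (imagPoint t))

/-- The Mellin–Barnes integral over `√-1 ℝ^d` with respect to `ds_1 ∧ ⋯ ∧ ds_d`. -/
def mbIntegral {N d : ℕ} (γ : Fin N → ℝ) (B : Matrix (Fin d) (Fin N) ℤ) (θ : Fin N → ℝ)
    (v : Fin N → ℂ) : ℂ :=
  Complex.I ^ d * ∫ t : Fin d → ℝ, mbIntegrand γ B θ v (imagPoint t)

/-- The germ `g` at `υ` is a determination of the Mellin–Barnes integral around `υ`: for some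
choice `θ` of arguments of the coordinates of `υ`, the integral converges absolutely around `υ`
and `g` is the germ of the function that it defines. -/
def IsMBDetermination {N d : ℕ} (γ : Fin N → ℝ) (B : Matrix (Fin d) (Fin N) ℤ)
    (υ : Fin N → ℂ) (g : Germ (𝓝 υ) ℂ) : Prop :=
  ∃ θ : Fin N → ℝ, (∀ j, υ j = (‖υ j‖ : ℂ) * Complex.exp (θ j * Complex.I)) ∧
    (∀ᶠ v in 𝓝 υ, MBConverges γ B θ v) ∧
    g = ((mbIntegral γ B θ : (Fin N → ℂ) → ℂ) : Germ (𝓝 υ) ℂ)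

/-- The system `H_A(α)` of rank `D` allows a Mellin–Barnes basis of solutions: around some point
of `(ℂ^*)^N` the space of local solutions has a basis of `D` elements, all of them determinations
of the Mellin–Barnes integral. -/
def HasMellinBarnesBasis {r N d : ℕ} (a : Fin N → Fin r → ℤ) (α : Fin r → ℝ) (γ : Fin N → ℝ)
    (B : Matrix (Fin d) (Fin N) ℤ) (D : ℕ) : Prop :=
  ∃ υ : Fin N → ℂ, (∀ j, υ j ≠ 0) ∧
    ∃ M : Module.Basis (Fin D) ℂ (localSolutions a α υ),
      ∀ k, IsMBDetermination γ B υ (M k : Germ (𝓝 υ) ℂ)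

/-- The zonotope `Z_B = {1/4 ∑ μ_j b_j | -1 < μ_j < 1}`. -/
def zonotope {N d : ℕ} (B : Matrix (Fin d) (Fin N) ℤ) : Set (Fin d → ℝ) :=
  {x | ∃ μ : Fin N → ℝ, (∀ j, μ j ∈ Set.Ioo (-1 : ℝ) 1) ∧
    x = fun k => (1 / 4 : ℝ) * ∑ j, μ j * (B k j : ℝ)}

end AHypergeometric

end

/-! On `s = √-1 t` the factor `Γ(-γ_j - b_j·s)` has modulus about `exp(-(π/2)|b_j·t|)`, and the
power of `v_j` contributes `exp(-θ_j b_j·t)` up to a constant. So convergence depends on comparing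
`∑ θ_j b_j·t` with `(π/2) ∑ |b_j·t|`. Put `τ = (1/2π) ∑ θ_j b_j`. Since `(1/4) ∑ |b_j·t|` is the
support function of the zonotope, the integral converges absolutely near a point with arguments `θ`
exactly when `τ ∈ Z_B`. Stirling's formula is not needed: for every `φ < π/2` the modulus is bounded
above by a multiple of `exp(-φ|Im|)` and below by one of `exp(-(π-φ)|Im|)` (`norm_Gamma_le`,
`exists_le_norm_Gamma`). The weak inequality obtained from convergence becomes strict because
convergence is assumed on a neighbourhood (`mem_zonotope_of_eventually_mbConverges`).

Where it converges the integral solves the system (`solvesAt_mbIntegral`). The Euler equations hold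
because the rows of `B` are relations. Each `∂_j` lowers `γ_j` by one and changes the sign, so a box
equation compares two integrals whose exponents differ by some `l ∈ L`; these agree by translating
the path of integration (`mellinIntegral_add_realForm`).

Replacing `θ` by `θ + 2πn` moves `τ` by the integer vector `Bn` and multiplies the integrand by a
constant and by `exp(-2π (Bn)·t)` (`mellinTerm_add_twoPiI`). If `Bn = 0` the two germs are
proportional, so a Mellin–Barnes basis yields `D` distinct points of `Z_B` with integral differences
(`HasMellinBarnesBasis.exists_zonotope`). Conversely, the columns of `B` generate `ℤ^d`
(`IsBMatrix.exists_mul_eq_one`), so `D` such points come from arguments of one point, which can be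
taken generic. The resulting germs are independent, by injectivity of the Fourier transform and
independence of characters (`eq_zero_of_eventually_sum_mellinIntegral_eq_zero`), and there are as
many as the rank. -/

noncomputable section

namespace AHypergeometric

/-! ### Integrals of exponentials of linear forms -/

section ExpIntegral

open scoped Nat

variable {E T : Type*} [NormedAddCommGroup E] [NormedSpace ℂ E] [MeasurableSpace T]

/-- The `n`-th Taylor coefficient of `v ↦ c * exp (l v)` at `0`. -/
def expTaylorCoeff (n : ℕ) (c : ℂ) (l : E →L[ℂ] ℂ) : E [×n]→L[ℂ] ℂ :=
  (c * (n ! : ℂ)⁻¹) •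
    (ContinuousMultilinearMap.mkPiAlgebraFin ℂ n ℂ).compContinuousLinearMap (fun _ => l)

theorem expTaylorCoeff_apply (n : ℕ) (c : ℂ) (l : E →L[ℂ] ℂ) (v : E) :
    expTaylorCoeff n c l (fun _ => v) = c * ((l v) ^ n / (n ! : ℂ)) := by
  simp [expTaylorCoeff, List.ofFn_const]
  ring

theorem norm_expTaylorCoeff_le (n : ℕ) (c : ℂ) (l : E →L[ℂ] ℂ) :
    ‖expTaylorCoeff n c l‖ ≤ ‖c‖ * (‖l‖ ^ n / n !) := by
  have h : ‖(ContinuousMultilinearMap.mkPiAlgebraFin ℂ n ℂ).compContinuousLinearMap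
      (fun _ => l)‖ ≤ ‖l‖ ^ n := by
    refine (ContinuousMultilinearMap.norm_compContinuousLinearMap_le _ _).trans ?_
    simp
  rw [expTaylorCoeff, norm_smul, norm_mul, norm_inv, Complex.norm_natCast]
  calc ‖c‖ * (n ! : ℝ)⁻¹ * _ ≤ ‖c‖ * (n ! : ℝ)⁻¹ * ‖l‖ ^ n := by gcongr
    _ = _ := by ring

theorem continuous_expTaylorCoeff (n : ℕ) :
    Continuous fun x : ℂ × (E →L[ℂ] ℂ) => expTaylorCoeff n x.1 x.2 := by
  have h1 : Continuous fun x : ℂ × (E →L[ℂ] ℂ) => x.1 * (n ! : ℂ)⁻¹ := by fun_prop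
  refine h1.smul ?_
  have h := (ContinuousMultilinearMap.compContinuousLinearMapContinuousMultilinear ℂ
    (fun _ : Fin n => E) (fun _ : Fin n => ℂ) ℂ).cont
  have h2 : Continuous fun x : ℂ × (E →L[ℂ] ℂ) => fun _ : Fin n => x.2 := by fun_prop
  exact (ContinuousLinearMap.apply ℂ _
    (ContinuousMultilinearMap.mkPiAlgebraFin ℂ n ℂ)).continuous.comp (h.comp h2)

variable {μ : Measure T} {G : T → ℂ} {ℓ : T → E →L[ℂ] ℂ}

theorem norm_expTaylorCoeff_mul_pow_le (n : ℕ) (c : ℂ) (l : E →L[ℂ] ℂ) {ρ : ℝ} (hρ : 0 ≤ ρ) :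
    ‖expTaylorCoeff n c l‖ * ρ ^ n ≤ ‖c‖ * Real.exp (ρ * ‖l‖) := by
  calc ‖expTaylorCoeff n c l‖ * ρ ^ n ≤ ‖c‖ * (‖l‖ ^ n / n !) * ρ ^ n := by
        gcongr; exact norm_expTaylorCoeff_le n c l
    _ = ‖c‖ * ((ρ * ‖l‖) ^ n / n !) := by rw [mul_pow]; ring
    _ ≤ _ := by gcongr; exact Real.pow_div_factorial_le_exp _ (by positivity) n

theorem integrable_expTaylorCoeff (hG : AEStronglyMeasurable G μ) (hℓ : AEStronglyMeasurable ℓ μ)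
    {ρ : ℝ} (hρ : 0 < ρ) (h : Integrable (fun t => ‖G t‖ * Real.exp (ρ * ‖ℓ t‖)) μ) (n : ℕ) :
    Integrable (fun t => expTaylorCoeff n (G t) (ℓ t)) μ := by
  refine Integrable.mono' (h.const_mul ((ρ ^ n)⁻¹))
    ((continuous_expTaylorCoeff n).comp_aestronglyMeasurable (hG.prodMk hℓ))
    (Eventually.of_forall fun t => ?_)
  have := norm_expTaylorCoeff_mul_pow_le n (G t) (ℓ t) hρ.le
  rw [inv_mul_eq_div, le_div_iff₀ (by positivity)]
  exact this

/-- The exponential series is integrated term by term. One exponential moment of `‖ℓ‖` suffices,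
because `(ρ‖ℓ‖)^n / n! ≤ exp(ρ‖ℓ‖)` bounds all coefficients at once and leaves a geometric series of
ratio `‖v‖/ρ`. -/
theorem hasFPowerSeriesOnBall_integral_exp (hG : AEStronglyMeasurable G μ)
    (hℓ : AEStronglyMeasurable ℓ μ) {ρ : ℝ} (hρ : 0 < ρ)
    (h : Integrable (fun t => ‖G t‖ * Real.exp (ρ * ‖ℓ t‖)) μ) :
    HasFPowerSeriesOnBall (fun v => ∫ t, G t * Complex.exp (ℓ t v) ∂μ)
      (fun n => ∫ t, expTaylorCoeff n (G t) (ℓ t) ∂μ) 0 (ENNReal.ofReal ρ) where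
  r_le := by
    refine FormalMultilinearSeries.le_radius_of_bound _
      (∫ t, ‖G t‖ * Real.exp (ρ * ‖ℓ t‖) ∂μ) fun n => ?_
    rw [Real.coe_toNNReal _ hρ.le]
    calc _ ≤ (∫ t, ‖expTaylorCoeff n (G t) (ℓ t)‖ ∂μ) * ρ ^ n := by
          gcongr; exact norm_integral_le_integral_norm _
      _ = ∫ t, ‖expTaylorCoeff n (G t) (ℓ t)‖ * ρ ^ n ∂μ := (integral_mul_const _ _).symm
      _ ≤ _ := integral_mono
          ((integrable_expTaylorCoeff hG hℓ hρ h n).norm.mul_const _) h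
          fun t => norm_expTaylorCoeff_mul_pow_le n _ _ hρ.le
  r_pos := by simpa using hρ
  hasSum := by
    intro v hv
    have hv' : ‖v‖ < ρ := by
      rw [Metric.mem_eball, edist_zero_right, ← ofReal_norm] at hv
      exact (ENNReal.ofReal_lt_ofReal_iff hρ).1 hv
    have hi := fun n => (integrable_expTaylorCoeff hG hℓ hρ h n)
    have e1 : ∀ n, (∫ t, expTaylorCoeff n (G t) (ℓ t) ∂μ) (fun _ => v)
        = ∫ t, expTaylorCoeff n (G t) (ℓ t) (fun _ => v) ∂μ := fun n =>
      ContinuousMultilinearMap.integral_apply (hi n) _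
    have hi' : ∀ n, Integrable (fun t => expTaylorCoeff n (G t) (ℓ t) (fun _ => v)) μ := fun n =>
      ((ContinuousMultilinearMap.apply ℂ (fun _ : Fin n => E) ℂ
        (fun _ => v)).integrable_comp (hi n))
    simp only [zero_add]
    have hs : ∀ t, HasSum (fun n => expTaylorCoeff n (G t) (ℓ t) (fun _ => v))
        (G t * Complex.exp (ℓ t v)) := fun t => by
      simp only [expTaylorCoeff_apply]
      refine HasSum.mul_left _ ?_
      rw [Complex.exp_eq_exp_ℂ]
      exact NormedSpace.exp_series_hasSum_exp' (𝕂 := ℂ) (ℓ t v) |>.congr_fun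
        fun n => by simp [div_eq_inv_mul]
    have hsum : Summable fun n => ∫ t, ‖expTaylorCoeff n (G t) (ℓ t) (fun _ => v)‖ ∂μ := by
      refine Summable.of_nonneg_of_le (fun n => integral_nonneg fun t => norm_nonneg _)
        (fun n => ?_) ((summable_geometric_of_lt_one (r := ‖v‖ / ρ) (by positivity)
          ((div_lt_one hρ).2 hv')).mul_right (∫ t, ‖G t‖ * Real.exp (ρ * ‖ℓ t‖) ∂μ))
      rw [← integral_const_mul]
      refine integral_mono (hi' n).norm (h.const_mul _) fun t => ?_
      have h1 := norm_expTaylorCoeff_mul_pow_le n (G t) (ℓ t) hρ.le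
      have h2 : ‖expTaylorCoeff n (G t) (ℓ t) (fun _ => v)‖
          ≤ ‖expTaylorCoeff n (G t) (ℓ t)‖ * ‖v‖ ^ n := by
        simpa using (expTaylorCoeff n (G t) (ℓ t)).le_opNorm (fun _ => v)
      refine h2.trans ?_
      calc _ = (‖v‖ / ρ) ^ n * (‖expTaylorCoeff n (G t) (ℓ t)‖ * ρ ^ n) := by
            rw [div_pow]; field_simp
        _ ≤ _ := by gcongr
    have := hasSum_integral_of_summable_integral_norm hi' hsum
    simp only [e1]
    convert this using 1
    exact integral_congr_ae (Eventually.of_forall fun t => (hs t).tsum_eq.symm)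

/-- Differentiation under the integral sign for `w ↦ ∫ G t * exp (ℓ t w)`. -/
theorem analyticAt_integral_exp (hG : AEStronglyMeasurable G μ)
    (hℓ : AEStronglyMeasurable ℓ μ) {ρ : ℝ} (hρ : 0 < ρ) (w : E)
    (h : Integrable (fun t => ‖G t * Complex.exp (ℓ t w)‖ * Real.exp (ρ * ‖ℓ t‖)) μ) :
    AnalyticAt ℂ (fun w => ∫ t, G t * Complex.exp (ℓ t w) ∂μ) w ∧
      ∀ v, fderiv ℂ (fun w => ∫ t, G t * Complex.exp (ℓ t w) ∂μ) w v
        = ∫ t, G t * Complex.exp (ℓ t w) * ℓ t v ∂μ := by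
  have hm : AEStronglyMeasurable (fun t => G t * Complex.exp (ℓ t w)) μ :=
    hG.mul (Complex.continuous_exp.comp_aestronglyMeasurable
      ((ContinuousLinearMap.apply ℂ ℂ w).continuous.comp_aestronglyMeasurable hℓ))
  have key := (hasFPowerSeriesOnBall_integral_exp hm hℓ hρ h).comp_sub w
  -- Absorbing `exp(ℓ t w)` into the amplitude moves the centre of the expansion from `0` to `w`.
  have e : (fun z => ∫ t, G t * Complex.exp (ℓ t w) * Complex.exp (ℓ t (z - w)) ∂μ)
      = fun w => ∫ t, G t * Complex.exp (ℓ t w) ∂μ := by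
    ext z
    congr with t
    rw [mul_assoc, ← Complex.exp_add, ← map_add, add_sub_cancel]
  rw [e, zero_add] at key
  refine ⟨key.analyticAt, fun v => ?_⟩
  rw [key.hasFPowerSeriesAt.hasFDerivAt.fderiv]
  have hi := integrable_expTaylorCoeff hm hℓ hρ h 1
  rw [continuousMultilinearCurryFin1_apply, ContinuousMultilinearMap.integral_apply hi]
  congr with t
  have : (Fin.snoc 0 v : Fin 1 → E) = fun _ => v := by
    ext i; fin_cases i; simp [Fin.snoc]
  rw [this, expTaylorCoeff_apply]
  simp

end ExpIntegral

/-! ### Holomorphic dependence on a complex parameter -/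

/-- Cauchy's estimate on circles of radius `R/4` turns the bound on `F` into a bound on its
derivative over the ball of radius `R/2`, so domination of `F` alone permits differentiation under
the integral. -/
theorem differentiableAt_integral_of_bound {T : Type*} [MeasurableSpace T] {μ : Measure T}
    {F : ℂ → T → ℂ} {ζ : ℂ} {R : ℝ} (hR : 0 < R) {bound : T → ℝ}
    (hm : ∀ z ∈ Metric.ball ζ R, AEStronglyMeasurable (F z) μ)
    (hd : ∀ t, DifferentiableOn ℂ (fun z => F z t) (Metric.ball ζ R))
    (hb : ∀ t, ∀ z ∈ Metric.ball ζ R, ‖F z t‖ ≤ bound t) (hint : Integrable bound μ) :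
    DifferentiableAt ℂ (fun z => ∫ t, F z t ∂μ) ζ := by
  have hd' : ∀ t, ∀ z ∈ Metric.ball ζ R, HasDerivAt (fun z => F z t) (deriv (fun z => F z t) z) z :=
    fun t z hz => ((hd t).differentiableAt (Metric.isOpen_ball.mem_nhds hz)).hasDerivAt
  have hcau : ∀ t, ∀ z ∈ Metric.ball ζ (R / 2), ‖deriv (fun z => F z t) z‖ ≤ bound t / (R / 4) := by
    intro t z hz
    have hsub : Metric.closedBall z (R / 4) ⊆ Metric.ball ζ R := by
      intro x hx
      rw [Metric.mem_closedBall] at hx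
      rw [Metric.mem_ball] at hz ⊢
      linarith [dist_triangle x z ζ]
    refine Complex.norm_deriv_le_of_forall_mem_sphere_norm_le (by positivity) ?_
      fun x hx => hb t x (hsub (Metric.sphere_subset_closedBall hx))
    refine DifferentiableOn.diffContOnCl ((hd t).mono ?_)
    exact (closure_mono Metric.ball_subset_closedBall).trans
      (by rwa [Metric.isClosed_closedBall.closure_eq])
  -- The derivative is measurable as a pointwise limit of difference quotients along a sequence
  -- inside the ball.
  have hF' : AEStronglyMeasurable (fun t => deriv (fun z => F z t) ζ) μ := by
    have hu : Tendsto (fun n : ℕ => ζ + ((R / 2 / (n + 1) : ℝ) : ℂ)) atTop (𝓝[≠] ζ) := by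
      refine tendsto_nhdsWithin_iff.2 ⟨?_, Eventually.of_forall fun n => ?_⟩
      · have h0 : Tendsto (fun n : ℕ => ((R / 2 / (n + 1) : ℝ))) atTop (𝓝 0) :=
          by simpa [div_eq_mul_inv] using
            (tendsto_one_div_add_atTop_nhds_zero_nat (𝕜 := ℝ)).const_mul (R / 2)
        have := ((Complex.continuous_ofReal.tendsto 0).comp h0).const_add ζ
        simpa using this
      · have : (R / 2 / ((n : ℝ) + 1)) ≠ 0 := by positivity
        simpa [-Complex.ofReal_div] using this
    refine aestronglyMeasurable_of_tendsto_ae (u := atTop)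
      (f := fun (n : ℕ) t => slope (fun z => F z t) ζ (ζ + ((R / 2 / (n + 1) : ℝ) : ℂ)))
      (fun n => ?_) (Eventually.of_forall fun t => ?_)
    · have hmem : ζ + ((R / 2 / (n + 1) : ℝ) : ℂ) ∈ Metric.ball ζ R := by
        rw [Metric.mem_ball, dist_eq_norm, add_sub_cancel_left, Complex.norm_real,
          Real.norm_of_nonneg (by positivity)]
        have : R / 2 / ((n : ℝ) + 1) ≤ R / 2 := div_le_self (by positivity) (by simp)
        linarith
      simp only [slope_def_module]
      exact ((hm _ hmem).sub (hm _ (Metric.mem_ball_self hR))).const_smul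
        (ζ + ((R / 2 / (n + 1) : ℝ) : ℂ) - ζ)⁻¹
    · exact (hasDerivAt_iff_tendsto_slope.1 (hd' t ζ (Metric.mem_ball_self hR))).comp hu
  refine (hasDerivAt_integral_of_dominated_loc_of_deriv_le
    (F' := fun z t => deriv (fun z => F z t) z) (Metric.ball_mem_nhds ζ (half_pos hR)) ?_ ?_ hF'
    (bound := fun t => bound t / (R / 4)) ?_ (hint.div_const _) ?_).2.differentiableAt
  · filter_upwards [Metric.ball_mem_nhds ζ hR] with z hz using hm z hz
  · exact hint.mono' (hm _ (Metric.mem_ball_self hR))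
      (Eventually.of_forall fun t => hb t _ (Metric.mem_ball_self hR))
  · exact Eventually.of_forall fun t z hz => hcau t z hz
  · exact Eventually.of_forall fun t z hz =>
      hd' t z (Metric.ball_subset_ball (by linarith) hz)

/-! ### Exponential decay of the Gamma function on vertical lines -/

section Gamma

-- Euler's integral along a rotated ray. Both sides are analytic in `r` on the right half-plane and
-- agree for positive real `r` by rescaling, so the identity theorem applies.
open Complex in
theorem integral_cpow_mul_exp_neg_mul_Ioi_of_re_pos {a r : ℂ} (ha : 0 < a.re) (hr : 0 < r.re) :
    r ^ a * ∫ t : ℝ in Set.Ioi 0, (t : ℂ) ^ (a - 1) * exp (-(t * r)) = Gamma a := by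
  set f : ℂ → ℂ := fun r => r ^ a * ∫ t : ℝ in Set.Ioi 0, (t : ℂ) ^ (a - 1) * exp (-(t * r))
    with hf
  have hopen : IsOpen {z : ℂ | 0 < z.re} := isOpen_lt continuous_const continuous_re
  have hconv : Convex ℝ {z : ℂ | 0 < z.re} := convex_halfSpace_re_gt 0
  have han : AnalyticOnNhd ℂ f {z : ℂ | 0 < z.re} := by
    intro z hz
    refine AnalyticAt.mul (analyticAt_id.cpow analyticAt_const (Or.inl hz)) ?_
    have hℓ : Continuous fun t : ℝ => (-(t : ℂ)) • ContinuousLinearMap.id ℂ ℂ := by fun_prop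
    have hG : AEStronglyMeasurable (fun t : ℝ => (t : ℂ) ^ (a - 1))
        (volume.restrict (Set.Ioi 0)) := by
      refine ContinuousOn.aestronglyMeasurable ?_ measurableSet_Ioi
      exact continuous_ofReal.continuousOn.cpow_const fun t ht => Or.inl (by simpa using ht)
    have := (analyticAt_integral_exp (E := ℂ) (μ := volume.restrict (Set.Ioi (0 : ℝ)))
      (G := fun t : ℝ => (t : ℂ) ^ (a - 1))
      (ℓ := fun t : ℝ => (-(t : ℂ)) • ContinuousLinearMap.id ℂ ℂ)
      hG hℓ.aestronglyMeasurable (ρ := z.re / 2) (half_pos hz) z ?_).1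
    · simpa using this
    · have hi : IntegrableOn (fun t : ℝ => t ^ (a.re - 1) * Real.exp (-(z.re / 2) * t ^ (1 : ℝ)))
          (Set.Ioi 0) :=
        integrableOn_rpow_mul_exp_neg_mul_rpow (by linarith) one_pos (half_pos hz)
      refine hi.congr_fun (fun t (ht : 0 < t) => ?_) measurableSet_Ioi
      have h2 : ‖(-(t : ℂ)) • ContinuousLinearMap.id ℂ ℂ‖ = t := by
        rw [norm_smul, ContinuousLinearMap.norm_id, norm_neg, norm_real, Real.norm_of_nonneg ht.le,
          mul_one]
      simp only [h2, norm_mul, norm_cpow_eq_rpow_re_of_pos ht, norm_exp]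
      rw [mul_assoc, ← Real.exp_add]
      simp
      left
      ring
  have hconst : AnalyticOnNhd ℂ (fun _ : ℂ => Gamma a) {z : ℂ | 0 < z.re} :=
    fun _ _ => analyticAt_const
  have heq : ∃ᶠ z in 𝓝[≠] (1 : ℂ), f z = Gamma a := by
    have hu : Tendsto (fun x : ℝ => (x : ℂ)) (𝓝[≠] (1 : ℝ)) (𝓝[≠] (1 : ℂ)) := by
      refine tendsto_nhdsWithin_iff.2 ⟨?_, ?_⟩
      · exact (continuous_ofReal.tendsto' (1 : ℝ) (1 : ℂ) (by simp)).mono_left nhdsWithin_le_nhds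
      · filter_upwards [self_mem_nhdsWithin] with x hx
        simpa using hx
    refine hu.frequently (Eventually.frequently ?_)
    filter_upwards [nhdsWithin_le_nhds (Ioi_mem_nhds (zero_lt_one' ℝ))] with x (hx : 0 < x)
    have := integral_cpow_mul_exp_neg_mul_Ioi ha hx
    simp only [hf]
    simp only [mul_comm (x : ℂ)] at this
    rw [this, ← mul_assoc, one_div, inv_cpow _ _ (by rw [arg_ofReal_of_nonneg hx.le]; positivity),
      mul_inv_cancel₀, one_mul]
    rw [cpow_def_of_ne_zero (by exact_mod_cast hx.ne')]
    exact exp_ne_zero _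
  exact han.eqOn_of_preconnected_of_frequently_eq hconst hconv.isPreconnected
    (z₀ := 1) (by simp) heq hr

-- Take `r = exp(±iφ)` in the rotated Euler integral: `|r^z| = exp(∓φ Im z)` gives the decay, with
-- the sign chosen as that of `Im z`, while the integral is dominated by a real one of rate `cos φ`.
open Complex in
theorem norm_Gamma_le {z : ℂ} (hz : 0 < z.re) {φ : ℝ} (h0 : 0 ≤ φ) (hφ : φ < Real.pi / 2) :
    ‖Gamma z‖ ≤ Real.Gamma z.re * (1 / Real.cos φ) ^ z.re * Real.exp (-(φ * |z.im|)) := by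
  have key : ∀ ψ : ℝ, |ψ| = φ → ‖Gamma z‖ ≤
      Real.Gamma z.re * (1 / Real.cos φ) ^ z.re * Real.exp (-(ψ * z.im)) := by
    intro ψ hψ
    have hc : 0 < Real.cos φ := Real.cos_pos_of_mem_Ioo ⟨by linarith, hφ⟩
    have hre : (exp (ψ * I)).re = Real.cos φ := by
      rw [exp_ofReal_mul_I_re, ← hψ, Real.cos_abs]
    have habs := abs_lt.1 (hψ.trans_lt hφ)
    rw [← integral_cpow_mul_exp_neg_mul_Ioi_of_re_pos hz (r := exp (ψ * I)) (hre ▸ hc), norm_mul,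
      norm_cpow_of_ne_zero (exp_ne_zero _), norm_exp_ofReal_mul_I, Real.one_rpow,
      arg_exp_mul_I, (toIocMod_eq_self _).2 ⟨by linarith [Real.pi_pos], by linarith [Real.pi_pos]⟩,
      one_div, ← Real.exp_neg, mul_comm (Real.exp _)]
    gcongr
    refine (norm_integral_le_integral_norm _).trans_eq ?_
    rw [mul_comm (Real.Gamma _), ← Real.integral_rpow_mul_exp_neg_mul_Ioi hz hc]
    refine setIntegral_congr_fun measurableSet_Ioi fun t (ht : 0 < t) => ?_
    simp only [norm_mul, norm_cpow_eq_rpow_re_of_pos ht, norm_exp]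
    rw [mul_comm] at hre
    simp [hre, mul_comm]
  rcases le_total 0 z.im with h | h
  · rw [abs_of_nonneg h]
    exact key φ (abs_of_nonneg h0)
  · rw [abs_of_nonpos h]
    have := key (-φ) (by rw [abs_neg, abs_of_nonneg h0])
    rwa [neg_mul, ← mul_neg] at this

/-- The decay is uniform for real parts in a compact subset of `(0, ∞)`. -/
theorem exists_norm_Gamma_le {p q : ℝ} (hp : 0 < p) {φ : ℝ} (h0 : 0 ≤ φ) (hφ : φ < Real.pi / 2) :
    ∃ C, 0 < C ∧ ∀ z : ℂ, z.re ∈ Set.Icc p q →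
      ‖Complex.Gamma z‖ ≤ C * Real.exp (-(φ * |z.im|)) := by
  have hc : 0 < Real.cos φ := Real.cos_pos_of_mem_Ioo ⟨by linarith, hφ⟩
  have hcont : ContinuousOn (fun x : ℝ => Real.Gamma x * (1 / Real.cos φ) ^ x) (Set.Icc p q) := by
    refine ContinuousOn.mul (fun x hx => ?_) ?_
    · refine (Real.differentiableAt_Gamma fun m => ?_).continuousAt.continuousWithinAt
      have : 0 < x := hp.trans_le hx.1
      have : (0 : ℝ) ≤ m := m.cast_nonneg
      linarith
    · exact (Real.continuous_const_rpow (by positivity)).continuousOn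
  obtain ⟨C, hC⟩ := isCompact_Icc.exists_bound_of_continuousOn hcont
  refine ⟨|C| + 1, by positivity, fun z hz => ?_⟩
  refine (norm_Gamma_le (hp.trans_le hz.1) h0 hφ).trans ?_
  gcongr
  linarith [le_abs_self C, (le_abs_self _).trans (hC _ hz)]

/-- Each use of `Γ(w+1) = wΓ(w)` multiplies by a number of modulus at least `|Im w| ≥ 1`. This
carries upper bounds from the right half-plane to points left of it. -/
theorem norm_Gamma_le_norm_Gamma_add_nat {w : ℂ} (hw : 1 ≤ |w.im|) (n : ℕ) :
    ‖Complex.Gamma w‖ ≤ ‖Complex.Gamma (w + n)‖ := by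
  induction n with
  | zero => simp
  | succ n ih =>
    have him : 1 ≤ ‖w + n‖ := by
      refine hw.trans ?_
      simpa using Complex.abs_im_le_norm (w + n)
    have hne : w + n ≠ 0 := by
      rw [← norm_pos_iff]; linarith
    rw [Nat.cast_succ, ← add_assoc, Complex.Gamma_add_one _ hne, norm_mul]
    nlinarith [norm_nonneg (Complex.Gamma (w + n))]

open Complex in
theorem norm_sin_le_exp (z : ℂ) : ‖sin z‖ ≤ Real.exp |z.im| := by
  have h1 : ‖exp (-z * I)‖ ≤ Real.exp |z.im| := by
    rw [norm_exp]; simp [le_abs_self]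
  have h2 : ‖exp (z * I)‖ ≤ Real.exp |z.im| := by
    rw [norm_exp]; simp [neg_le_abs]
  rw [sin, norm_div, norm_mul, norm_I, mul_one]
  have := norm_sub_le (exp (-z * I)) (exp (z * I))
  have h3 : ‖(2 : ℂ)‖ = 2 := by simp
  rw [h3]
  linarith

-- For `|Im z| > 1` the reflection formula `Γ(z)Γ(1-z) sin(πz) = π` converts upper bounds for
-- `Γ(1-z)` and for the sine into a lower bound; the remaining segment is compact and `Γ` has no
-- zeros there.
open Complex in
theorem exists_le_norm_Gamma {σ : ℝ} (hσ : 0 < σ) {φ : ℝ} (h0 : 0 ≤ φ) (hφ : φ < Real.pi / 2) :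
    ∃ c, 0 < c ∧ ∀ z : ℂ, z.re = σ → c * Real.exp (-((Real.pi - φ) * |z.im|)) ≤ ‖Gamma z‖ := by
  obtain ⟨n, hn⟩ := exists_nat_gt σ
  -- `1 - z` may have negative real part, so it is moved right by `n > σ` before the upper bound is
  -- used.
  obtain ⟨C, hC0, hC⟩ := exists_norm_Gamma_le (p := 1 - σ + n) (q := 1 - σ + n) (by linarith) h0 hφ
  obtain ⟨y₀, -, hy₀⟩ := isCompact_Icc.exists_isMinOn (Set.nonempty_Icc.2 (by norm_num : (-1 : ℝ) ≤ 1))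
    (f := fun y : ℝ => ‖Gamma (σ + y * I)‖) (by
      refine (Continuous.norm ?_).continuousOn
      refine continuous_iff_continuousAt.2 fun y => ?_
      refine (differentiableAt_Gamma _ fun m h => ?_).continuousAt.comp
        (f := fun y : ℝ => (σ : ℂ) + y * I) (by fun_prop)
      have := congrArg re h
      simp at this
      have : (0 : ℝ) ≤ m := m.cast_nonneg
      linarith)
  have hpos : ∀ y : ℝ, 0 < ‖Gamma (σ + y * I)‖ := fun y =>
    norm_pos_iff.2 (Gamma_ne_zero_of_re_pos (by simpa using hσ))
  refine ⟨min ‖Gamma (σ + y₀ * I)‖ (Real.pi / C), lt_min (hpos _) (by positivity), fun z hz => ?_⟩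
  rcases le_or_gt |z.im| 1 with hy | hy
  · have h1 : ‖Gamma (σ + y₀ * I)‖ ≤ ‖Gamma z‖ := by
      have := hy₀ (Set.mem_Icc.2 (abs_le.1 hy))
      have e : z = σ + z.im * I := by rw [← hz, re_add_im]
      rw [e]
      simpa using this
    have h2 : Real.exp (-((Real.pi - φ) * |z.im|)) ≤ 1 := by
      refine Real.exp_le_one_iff.2 ?_
      have : 0 ≤ Real.pi - φ := by linarith [Real.pi_pos]
      have := mul_nonneg this (abs_nonneg z.im)
      linarith
    calc _ ≤ ‖Gamma (σ + y₀ * I)‖ * 1 := by gcongr; exact min_le_left _ _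
      _ ≤ _ := by rwa [mul_one]
  · have him : z.im ≠ 0 := by intro h; rw [h] at hy; norm_num at hy
    have hG : Gamma z ≠ 0 := Gamma_ne_zero_of_re_pos (hz ▸ hσ)
    have hG' : Gamma (1 - z) ≠ 0 := Gamma_ne_zero fun m h => him (by simpa using congrArg im h)
    have hrefl := Gamma_mul_Gamma_one_sub z
    have hs : sin (Real.pi * z) ≠ 0 := by
      intro h
      rw [h, div_zero] at hrefl
      exact mul_ne_zero hG hG' hrefl
    have hb : ‖Gamma (1 - z)‖ ≤ C * Real.exp (-(φ * |z.im|)) := by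
      refine (norm_Gamma_le_norm_Gamma_add_nat (by simpa using hy.le) n).trans ?_
      simpa [hz] using hC (1 - z + n) (by simp [hz])
    have hsin : ‖sin (Real.pi * z)‖ ≤ Real.exp (Real.pi * |z.im|) := by
      simpa [abs_mul, abs_of_pos Real.pi_pos] using norm_sin_le_exp (Real.pi * z)
    have hprod : ‖Gamma z‖ * (‖Gamma (1 - z)‖ * ‖sin (Real.pi * z)‖) = Real.pi := by
      rw [← norm_mul, ← norm_mul, ← mul_assoc, hrefl, div_mul_cancel₀ _ hs, norm_real,
        Real.norm_of_nonneg Real.pi_pos.le]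
    have h3 : ‖Gamma (1 - z)‖ * ‖sin (Real.pi * z)‖ ≤ C * Real.exp ((Real.pi - φ) * |z.im|) := by
      calc _ ≤ (C * Real.exp (-(φ * |z.im|))) * Real.exp (Real.pi * |z.im|) := by gcongr
        _ = _ := by rw [mul_assoc, ← Real.exp_add]; ring_nf
    calc _ ≤ Real.pi / C * Real.exp (-((Real.pi - φ) * |z.im|)) := by
          gcongr; exact min_le_right _ _
      _ = Real.pi / (C * Real.exp ((Real.pi - φ) * |z.im|)) := by
          rw [Real.exp_neg]; field_simp
      _ ≤ Real.pi / (‖Gamma (1 - z)‖ * ‖sin (Real.pi * z)‖) := by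
          gcongr
      _ = ‖Gamma z‖ := by
          rw [div_eq_iff (mul_pos (norm_pos_iff.2 hG') (norm_pos_iff.2 hs)).ne', hprod]

end Gamma

/-! ### The columns of a B-matrix -/

section Columns

variable {r N d : ℕ}

/-- A B-matrix has an integral right inverse: its columns span `ℤ^d`. -/
theorem IsBMatrix.exists_mul_eq_one {a : Fin N → Fin r → ℤ} (ha : IsASet a)
    {B : Matrix (Fin d) (Fin N) ℤ} (hB : IsBMatrix a B) :
    ∃ R : Matrix (Fin N) (Fin d) ℤ, B * R = 1 := by
  set p : (Fin N → ℤ) →ₗ[ℤ] (Fin r → ℤ) := Fintype.linearCombination ℤ a with hp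
  have hsurj : Function.Surjective p := by
    rw [← LinearMap.range_eq_top, hp, Fintype.range_linearCombination, ha.span_eq_top]
  -- The surjection `ℤ^N → ℤ^r` splits, so `x ↦ x - s (p x)` retracts `ℤ^N` onto `L`. Its
  -- coordinates in the basis of rows give the right inverse.
  obtain ⟨s, hs⟩ := Module.projective_lifting_property p LinearMap.id hsurj
  have hs' : ∀ x, p (s x) = x := fun x => LinearMap.congr_fun hs x
  have hmem : ∀ x, x - s (p x) ∈ relationLattice a := fun x => by
    have : p (x - s (p x)) = 0 := by rw [map_sub, hs', sub_self]
    rw [hp, Fintype.linearCombination_apply] at this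
    exact this
  have hli : LinearIndependent ℤ (fun k : Fin d => B k) := hB.1
  let b := Module.Basis.span hli
  let e : (Fin N → ℤ) →ₗ[ℤ] Submodule.span ℤ (Set.range fun k : Fin d => B k) :=
    (LinearMap.id - s ∘ₗ p).codRestrict _ fun x => by
      rw [hB.2]; exact hmem x
  let ρ : (Fin N → ℤ) →ₗ[ℤ] (Fin d → ℤ) := b.equivFun.toLinearMap ∘ₗ e
  have hpB : ∀ k, p (B k) = 0 := fun k => by
    have : B k ∈ relationLattice a := by
      rw [← hB.2]; exact Submodule.subset_span ⟨k, rfl⟩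
    rw [hp, Fintype.linearCombination_apply]
    exact this
  have hρ : ∀ k, ρ (B k) = Pi.single k 1 := fun k => by
    have h1 : e (B k) = b k := by
      apply Subtype.ext
      simp [e, b, hpB, Module.Basis.span_apply]
    simp only [ρ, LinearMap.comp_apply, h1, LinearEquiv.coe_coe]
    ext i
    simp [Pi.single_apply, eq_comm]
  refine ⟨Matrix.of fun j k => ρ (Pi.single j 1) k, ?_⟩
  ext k k'
  have h2 : B k = ∑ j, B k j • (Pi.single j 1 : Fin N → ℤ) := by
    ext i; simp [Finset.sum_apply, Pi.single_apply]
  have h3 := congrFun (hρ k) k'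
  rw [h2, map_sum] at h3
  simp only [map_smul, Finset.sum_apply, Pi.smul_apply, smul_eq_mul] at h3
  rw [Matrix.mul_apply]
  simp only [Matrix.of_apply, h3, Matrix.one_apply, Pi.single_apply, eq_comm]

theorem IsBMatrix.sum_smul_eq_zero {a : Fin N → Fin r → ℤ}
    {B : Matrix (Fin d) (Fin N) ℤ} (hB : IsBMatrix a B) (k : Fin d) (i : Fin r) :
    ∑ j, B k j * a j i = 0 := by
  have : B k ∈ relationLattice a := by
    rw [← hB.2]; exact Submodule.subset_span ⟨k, rfl⟩
  have h := congrFun (show ∑ j, B k j • a j = 0 from this) i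
  simpa using h

theorem IsBMatrix.exists_eq_sum {a : Fin N → Fin r → ℤ}
    {B : Matrix (Fin d) (Fin N) ℤ} (hB : IsBMatrix a B) {l : Fin N → ℤ}
    (hl : l ∈ relationLattice a) : ∃ m : Fin d → ℤ, ∀ j, l j = ∑ k, B k j * m k := by
  rw [← hB.2, Submodule.mem_span_range_iff_exists_fun] at hl
  obtain ⟨m, rfl⟩ := hl
  exact ⟨m, fun j => by simp [mul_comm]⟩

/-- Apply the form `h` to the relation. Consequently the two sides of a box equation are operators
of the same order, and the signs produced by differentiation agree. -/
theorem IsASet.sum_eq_zero {a : Fin N → Fin r → ℤ} (ha : IsASet a) {l : Fin N → ℤ}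
    (hl : l ∈ relationLattice a) : ∑ j, l j = 0 := by
  obtain ⟨h, hh⟩ := ha.exists_form
  have h1 : ∑ j, (l j : ℝ) • toReal (a j) = 0 := by
    ext i
    have := congrFun (show ∑ j, l j • a j = 0 from hl) i
    simp only [Finset.sum_apply, Pi.smul_apply, smul_eq_mul, Pi.zero_apply] at this
    simp only [toReal, Finset.sum_apply, Pi.smul_apply, smul_eq_mul, Pi.zero_apply]
    exact_mod_cast this
  have h2 := congrArg h h1
  simp only [map_sum, map_smul, hh, smul_eq_mul, mul_one, map_zero] at h2
  exact_mod_cast h2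

variable (B : Matrix (Fin d) (Fin N) ℤ)

/-- The real linear form `b_j · t`. -/
def realForm (j : Fin N) (t : Fin d → ℝ) : ℝ := ∑ k, (B k j : ℝ) * t k

/-- The norm `∑ |b_j · t|`. -/
def absSum (t : Fin d → ℝ) : ℝ := ∑ j, |realForm B j t|

@[fun_prop]
theorem continuous_realForm (j : Fin N) : Continuous (realForm B j) := by
  unfold realForm; fun_prop

@[fun_prop]
theorem continuous_absSum : Continuous (absSum B) := by
  unfold absSum; fun_prop

theorem realForm_smul (j : Fin N) (c : ℝ) (t : Fin d → ℝ) :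
    realForm B j (c • t) = c * realForm B j t := by
  simp only [realForm, Finset.mul_sum, Pi.smul_apply, smul_eq_mul]
  exact Finset.sum_congr rfl fun _ _ => by ring

theorem realForm_add (j : Fin N) (t u : Fin d → ℝ) :
    realForm B j (t + u) = realForm B j t + realForm B j u := by
  simp only [realForm, ← Finset.sum_add_distrib, Pi.add_apply, mul_add]

theorem absSum_smul (c : ℝ) (t : Fin d → ℝ) : absSum B (c • t) = |c| * absSum B t := by
  simp only [absSum, realForm_smul, abs_mul, Finset.mul_sum]

theorem absSum_nonneg (t : Fin d → ℝ) : 0 ≤ absSum B t :=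
  Finset.sum_nonneg fun _ _ => abs_nonneg _

theorem abs_realForm_le_absSum (j : Fin N) (t : Fin d → ℝ) : |realForm B j t| ≤ absSum B t :=
  Finset.single_le_sum (f := fun j => |realForm B j t|) (fun _ _ => abs_nonneg _)
    (Finset.mem_univ j)

variable {B}

theorem eq_sum_mul_realForm {R : Matrix (Fin N) (Fin d) ℤ} (hR : B * R = 1) (t : Fin d → ℝ)
    (k : Fin d) : t k = ∑ j, (R j k : ℝ) * realForm B j t := by
  have h : ∀ k', ∑ j, (B k' j : ℝ) * R j k = if k' = k then 1 else 0 := fun k' => by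
    have := congrFun (congrFun hR k') k
    rw [Matrix.mul_apply, Matrix.one_apply] at this
    exact_mod_cast this
  simp only [realForm, Finset.mul_sum]
  rw [Finset.sum_comm]
  have : ∀ k', ∑ j, (R j k : ℝ) * ((B k' j : ℝ) * t k') = (if k' = k then 1 else 0) * t k' :=
    fun k' => by
      rw [← h k', Finset.sum_mul]
      exact Finset.sum_congr rfl fun _ _ => by ring
  simp [this]

/-- The right inverse recovers `t` linearly from the values `b_j·t`, so decay in `absSum` is decay
in `‖t‖`. -/
theorem exists_norm_le_absSum {R : Matrix (Fin N) (Fin d) ℤ} (hR : B * R = 1) :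
    ∃ C, 0 < C ∧ ∀ t, ‖t‖ ≤ C * absSum B t := by
  have hM : 0 ≤ ∑ k, ∑ j, |(R j k : ℝ)| := by positivity
  refine ⟨∑ k, ∑ j, |(R j k : ℝ)| + 1, by positivity, fun t => ?_⟩
  have hS := absSum_nonneg B t
  refine (pi_norm_le_iff_of_nonneg (by positivity)).2 fun k => ?_
  rw [Real.norm_eq_abs, eq_sum_mul_realForm hR t k]
  calc _ ≤ ∑ j, |(R j k : ℝ)| * absSum B t := by
        refine (Finset.abs_sum_le_sum_abs _ _).trans (Finset.sum_le_sum fun j _ => ?_)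
        rw [abs_mul]
        gcongr
        exact abs_realForm_le_absSum B j t
    _ = (∑ j, |(R j k : ℝ)|) * absSum B t := (Finset.sum_mul _ _ _).symm
    _ ≤ _ := by
        gcongr
        have : ∑ j, |(R j k : ℝ)| ≤ ∑ k, ∑ j, |(R j k : ℝ)| :=
          Finset.single_le_sum (f := fun k => ∑ j, |(R j k : ℝ)|)
            (fun _ _ => by positivity) (Finset.mem_univ k)
        linarith

theorem integrable_exp_neg_mul_norm {κ : ℝ} (hκ : 0 < κ) :
    Integrable (fun t : Fin d → ℝ => Real.exp (-(κ * ‖t‖))) := by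
  have h1 : Integrable (fun t : Fin d → ℝ => (1 + ‖t‖) ^ (-((d + 1 : ℕ) : ℝ))) :=
    integrable_one_add_norm (by simp)
  -- The constant comes from `x^(d+1)/(d+1)! ≤ exp x` at `x = κ(1 + ‖t‖)`.
  refine (h1.const_mul (((d + 1).factorial : ℝ) * (κ ^ (d + 1))⁻¹ * Real.exp κ)).mono'
    (by fun_prop) (Eventually.of_forall fun t => ?_)
  have h2 := Real.pow_div_factorial_le_exp (κ * (1 + ‖t‖)) (by positivity) (d + 1)
  have h0 : 0 < 1 + ‖t‖ := by positivity
  rw [Real.norm_of_nonneg (Real.exp_pos _).le, Real.rpow_neg h0.le, Real.rpow_natCast]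
  rw [mul_pow, div_le_iff₀ (by positivity)] at h2
  have h3 : Real.exp (κ * (1 + ‖t‖)) = Real.exp κ * Real.exp (κ * ‖t‖) := by
    rw [← Real.exp_add]; ring_nf
  rw [h3] at h2
  rw [Real.exp_neg, inv_eq_one_div, div_le_iff₀ (Real.exp_pos _)]
  have h4 : 0 < κ ^ (d + 1) * (1 + ‖t‖) ^ (d + 1) := by positivity
  calc (1 : ℝ) = (κ ^ (d + 1) * (1 + ‖t‖) ^ (d + 1)) / (κ ^ (d + 1) * (1 + ‖t‖) ^ (d + 1)) :=
        (div_self h4.ne').symm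
    _ ≤ (Real.exp κ * Real.exp (κ * ‖t‖) * ((d + 1).factorial : ℝ)) /
          (κ ^ (d + 1) * (1 + ‖t‖) ^ (d + 1)) := by gcongr
    _ = _ := by field_simp

theorem integrable_exp_neg_mul_absSum {R : Matrix (Fin N) (Fin d) ℤ} (hR : B * R = 1) {κ : ℝ}
    (hκ : 0 < κ) : Integrable (fun t => Real.exp (-(κ * absSum B t))) := by
  obtain ⟨C, hC, h⟩ := exists_norm_le_absSum hR
  refine (integrable_exp_neg_mul_norm (d := d) (div_pos hκ hC)).mono' (by fun_prop)
    (Eventually.of_forall fun t => ?_)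
  rw [Real.norm_of_nonneg (Real.exp_pos _).le]
  refine Real.exp_le_exp.2 (neg_le_neg ?_)
  rw [div_mul_eq_mul_div, div_le_iff₀ hC]
  have := mul_le_mul_of_nonneg_left (h t) hκ.le
  linarith

end Columns

/-! ### Admissible arguments and the zonotope -/

section Zonotope

variable {N d : ℕ}

/-- The arguments `y` satisfy `|∑ y_j b_j · t| ≤ (π / 2) ρ ∑ |b_j · t|` for some `ρ < 1`. -/
def Admissible (B : Matrix (Fin d) (Fin N) ℤ) (y : Fin N → ℝ) : Prop :=
  ∃ ρ : ℝ, 0 ≤ ρ ∧ ρ < 1 ∧ ∀ t, |∑ j, y j * realForm B j t| ≤ Real.pi / 2 * ρ * absSum B t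

variable {B : Matrix (Fin d) (Fin N) ℤ}

theorem sum_mul_realForm (y : Fin N → ℝ) (t : Fin d → ℝ) :
    ∑ j, y j * realForm B j t = ∑ k, (∑ j, y j * (B k j : ℝ)) * t k := by
  simp only [realForm, Finset.mul_sum, Finset.sum_mul]
  rw [Finset.sum_comm]
  exact Finset.sum_congr rfl fun _ _ => Finset.sum_congr rfl fun _ _ => by ring

theorem admissible_of_mem_zonotope {y : Fin N → ℝ} {τ : Fin d → ℝ} (hτ : τ ∈ zonotope B)
    (hy : ∀ k, ∑ j, y j * (B k j : ℝ) = 2 * Real.pi * τ k) : Admissible B y := by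
  obtain ⟨μ, hμ, rfl⟩ := hτ
  -- A maximum of finitely many numbers below `1` is below `1`; taken in `NNReal`, it also makes
  -- sense for an empty index set.
  set ρ : NNReal := Finset.univ.sup fun j => ‖μ j‖₊ with hρ
  have hρ1 : ρ < 1 := by
    refine (Finset.sup_lt_iff (by simp)).2 fun j _ => ?_
    rw [← NNReal.coe_lt_coe, coe_nnnorm, Real.norm_eq_abs]
    exact abs_lt.2 (hμ j)
  have hμρ : ∀ j, |μ j| ≤ ρ := fun j => by
    rw [← Real.norm_eq_abs, ← coe_nnnorm, NNReal.coe_le_coe]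
    exact Finset.le_sup (f := fun j => ‖μ j‖₊) (Finset.mem_univ j)
  refine ⟨ρ, ρ.2, by exact_mod_cast hρ1, fun t => ?_⟩
  have h1 : ∑ j, y j * realForm B j t = Real.pi / 2 * ∑ j, μ j * realForm B j t := by
    rw [sum_mul_realForm, sum_mul_realForm, Finset.mul_sum]
    refine Finset.sum_congr rfl fun k _ => ?_
    rw [hy]; ring
  rw [h1, abs_mul, abs_of_pos (by positivity), mul_assoc]
  gcongr
  refine (Finset.abs_sum_le_sum_abs _ _).trans ?_
  rw [absSum, Finset.mul_sum]
  refine Finset.sum_le_sum fun j _ => ?_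
  rw [abs_mul]
  gcongr
  exact hμρ j

/-- Half of the slack `1 - ρ` is spent on the perturbation, which leaves the constant `(1 + ρ)/2 <
1`. -/
theorem Admissible.exists_forall_near {y : Fin N → ℝ} (hy : Admissible B y) :
    ∃ δ, 0 < δ ∧ ∀ y' : Fin N → ℝ, (∀ j, |y' j - y j| < δ) → Admissible B y' := by
  obtain ⟨ρ, h0, h1, h⟩ := hy
  have hpi := Real.pi_pos
  refine ⟨Real.pi / 2 * ((1 - ρ) / 2), by have : 0 < 1 - ρ := by linarith
                                          positivity,
    fun y' hy' => ⟨(1 + ρ) / 2, by linarith, by linarith, fun t => ?_⟩⟩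
  have e : ∑ j, y' j * realForm B j t
      = ∑ j, y j * realForm B j t + ∑ j, (y' j - y j) * realForm B j t := by
    rw [← Finset.sum_add_distrib]
    exact Finset.sum_congr rfl fun _ _ => by ring
  have h2 : |∑ j, (y' j - y j) * realForm B j t| ≤ Real.pi / 2 * ((1 - ρ) / 2) * absSum B t := by
    refine (Finset.abs_sum_le_sum_abs _ _).trans ?_
    rw [absSum, Finset.mul_sum]
    refine Finset.sum_le_sum fun j _ => ?_
    rw [abs_mul]
    gcongr
    exact (hy' j).le
  rw [e]
  refine (abs_add_le _ _).trans ((add_le_add (h t) h2).trans_eq ?_)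
  ring

theorem isOpen_admissible : IsOpen {y : Fin N → ℝ | Admissible B y} := by
  refine Metric.isOpen_iff.2 fun y hy => ?_
  obtain ⟨δ, hδ, h⟩ := Admissible.exists_forall_near hy
  refine ⟨δ, hδ, fun y' hy' => h y' fun j => ?_⟩
  rw [Metric.mem_ball] at hy'
  exact (dist_le_pi_dist y' y j).trans_lt hy'

theorem convex_zonotope : Convex ℝ (zonotope B) := by
  rintro _ ⟨μ, hμ, rfl⟩ _ ⟨ν, hν, rfl⟩ a b ha hb hab
  refine ⟨a • μ + b • ν, fun j => convex_Ioo (-1 : ℝ) 1 (hμ j) (hν j) ha hb hab, ?_⟩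
  ext k
  simp only [Pi.add_apply, Pi.smul_apply, smul_eq_mul, add_mul, mul_add,
    Finset.sum_add_distrib, Finset.mul_sum]
  congr 1 <;> exact Finset.sum_congr rfl fun _ _ => by ring

/-- The zonotope is the image of an open cube under a linear map, which is surjective, hence open,
because `B` has a right inverse. -/
theorem isOpen_zonotope {R : Matrix (Fin N) (Fin d) ℤ} (hR : B * R = 1) :
    IsOpen (zonotope B) := by
  let L : (Fin N → ℝ) →ₗ[ℝ] (Fin d → ℝ) :=
    { toFun := fun μ k => (1 / 4 : ℝ) * ∑ j, μ j * (B k j : ℝ)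
      map_add' := fun x y => by
        ext k; simp [add_mul, Finset.sum_add_distrib, mul_add]
      map_smul' := fun c x => by
        ext k; simp [mul_assoc, ← Finset.mul_sum]; ring }
  have hL : Function.Surjective L := by
    intro t
    refine ⟨fun j => 4 * ∑ k, (R j k : ℝ) * t k, ?_⟩
    ext k
    have h : ∀ k', ∑ j, (B k j : ℝ) * R j k' = if k = k' then 1 else 0 := fun k' => by
      have := congrFun (congrFun hR k) k'
      rw [Matrix.mul_apply, Matrix.one_apply] at this
      exact_mod_cast this
    have h2 : ∑ j, (4 * ∑ k', (R j k' : ℝ) * t k') * (B k j : ℝ)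
        = 4 * ∑ k', (∑ j, (B k j : ℝ) * R j k') * t k' := by
      simp only [Finset.mul_sum, Finset.sum_mul]
      rw [Finset.sum_comm]
      exact Finset.sum_congr rfl fun _ _ => Finset.sum_congr rfl fun _ _ => by ring
    simp [L, h2, h]
  have hopen : IsOpen (Set.univ.pi fun _ : Fin N => Set.Ioo (-1 : ℝ) 1) :=
    isOpen_set_pi Set.finite_univ fun _ _ => isOpen_Ioo
  convert L.isOpenMap_of_finiteDimensional hL _ hopen using 1
  ext x
  simp only [zonotope, Set.mem_image, Set.mem_pi, Set.mem_univ, true_implies, L,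
    LinearMap.coe_mk, AddHom.coe_mk, Set.mem_ofPred_eq]
  exact exists_congr fun μ => and_congr_right fun _ => eq_comm

/-- A point outside of the zonotope is separated from it by an inequality for the support
function. -/
theorem exists_absSum_le_of_notMem_zonotope {R : Matrix (Fin N) (Fin d) ℤ} (hR : B * R = 1)
    {τ : Fin d → ℝ} (hτ : τ ∉ zonotope B) :
    ∃ t, 0 < absSum B t ∧ 1 / 4 * absSum B t ≤ ∑ k, τ k * t k := by
  obtain ⟨f, hf⟩ := geometric_hahn_banach_open_point convex_zonotope (isOpen_zonotope hR) hτ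
  set t : Fin d → ℝ := fun k => f (Pi.single k 1) with ht
  have hft : ∀ x, f x = ∑ k, x k * t k := fun x => by
    conv_lhs => rw [pi_eq_sum_univ' x]
    simp [ht]
  have hval : ∀ μ : Fin N → ℝ, f (fun k => (1 / 4 : ℝ) * ∑ j, μ j * (B k j : ℝ))
      = 1 / 4 * ∑ j, μ j * realForm B j t := fun μ => by
    rw [hft, sum_mul_realForm, Finset.mul_sum]
    exact Finset.sum_congr rfl fun _ _ => by ring
  -- The zonotope contains `0`; strict separation from it excludes `t = 0`.
  have hpos : 0 < ∑ k, τ k * t k := by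
    have := hf _ ⟨0, fun j => by simp, rfl⟩
    rw [hval, hft] at this
    simpa using this
  refine ⟨t, ?_, ?_⟩
  · refine lt_of_le_of_ne (absSum_nonneg B t) fun h0 => ?_
    obtain ⟨C, hC, h⟩ := exists_norm_le_absSum hR
    have ht0 : t = 0 := by
      rw [← norm_le_zero_iff]
      simpa [← h0] using h t
    simp [ht0] at hpos
  · have hlim : Tendsto (fun ε : ℝ => 1 / 4 * ((1 - ε) * absSum B t)) (𝓝[>] 0)
        (𝓝 (1 / 4 * ((1 - 0) * absSum B t))) := by
      refine Tendsto.mono_left ?_ nhdsWithin_le_nhds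
      exact Continuous.tendsto (by fun_prop) 0
    rw [sub_zero, one_mul] at hlim
    refine le_of_tendsto hlim ?_
    filter_upwards [Ioo_mem_nhdsGT (zero_lt_one' ℝ)] with ε hε
    -- The signs of `b_j·t` maximise the form over the closed cube but lie outside the open one;
    -- hence the factor `1 - ε` and the limit `ε → 0`.
    have := hf _ ⟨fun j => (1 - ε) * SignType.sign (realForm B j t), fun j => ?_, rfl⟩
    · rw [hval, hft] at this
      refine le_of_eq_of_le ?_ this.le
      rw [absSum, Finset.mul_sum]
      congr 1
      refine Finset.sum_congr rfl fun j _ => ?_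
      rw [mul_assoc, sign_mul_self]
    · rw [Set.mem_Ioo, ← abs_lt, abs_mul, abs_of_pos (by linarith [hε.2])]
      have : |((SignType.sign (realForm B j t) : SignType) : ℝ)| ≤ 1 := by
        rcases SignType.sign (realForm B j t) with _ | _ | _ <;> simp
      nlinarith [hε.1, hε.2]

end Zonotope

/-! ### Open cones have infinite measure -/

-- Doubling preserves the cone but multiplies its volume by `2^d > 1`, which is impossible for a
-- positive finite volume.
open scoped Pointwise in
theorem measure_cone_eq_top {d : ℕ} (hd : 0 < d) {s : Set (Fin d → ℝ)} (hs : IsOpen s)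
    (hne : s.Nonempty) (hcone : ∀ c : ℝ, 0 < c → ∀ t ∈ s, c • t ∈ s) : volume s = ⊤ := by
  by_contra hfin
  have hpos : 0 < volume s := hs.measure_pos volume hne
  have h2 : (2 : ℝ) • s = s := by
    ext x
    rw [Set.mem_smul_set_iff_inv_smul_mem₀ two_ne_zero]
    refine ⟨fun h => ?_, fun h => hcone _ (by norm_num) _ h⟩
    simpa using hcone 2 two_pos _ h
  have h3 := Measure.addHaar_smul volume (2 : ℝ) s
  rw [h2, Module.finrank_fin_fun, abs_of_pos (by positivity)] at h3
  have h4 : (1 : ENNReal) < ENNReal.ofReal (2 ^ d) := by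
    rw [ENNReal.one_lt_ofReal]
    exact one_lt_pow₀ one_lt_two hd.ne'
  have := (ENNReal.mul_lt_mul_iff_left hpos.ne' hfin).2 h4
  rw [one_mul, ← h3] at this
  exact lt_irrefl _ this

/-! ### The Mellin–Barnes integral in logarithmic coordinates -/

section Mellin

variable {N d : ℕ}

/-- `∏ Γ(-z_j) e^(z_j w_j)`. -/
def mellinTerm (z w : Fin N → ℂ) : ℂ :=
  ∏ j, Complex.Gamma (-z j) * Complex.exp (z j * w j)

/-- The point with coordinates `γ_j + √-1 b_j · t`. -/
def mellinPoint (γ : Fin N → ℝ) (B : Matrix (Fin d) (Fin N) ℤ) (t : Fin d → ℝ) : Fin N → ℂ :=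
  fun j => γ j + Complex.I * realForm B j t

/-- The Mellin–Barnes integral as a function of `w_j = log v_j`. -/
def mellinIntegral (γ : Fin N → ℝ) (B : Matrix (Fin d) (Fin N) ℤ) (w : Fin N → ℂ) : ℂ :=
  ∫ t : Fin d → ℝ, mellinTerm (mellinPoint γ B t) w

theorem mellinTerm_eq (z w : Fin N → ℂ) :
    mellinTerm z w = (∏ j, Complex.Gamma (-z j)) * Complex.exp (∑ j, z j * w j) := by
  rw [mellinTerm, Finset.prod_mul_distrib, Complex.exp_sum]

theorem norm_mellinTerm (z w : Fin N → ℂ) :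
    ‖mellinTerm z w‖ = (∏ j, ‖Complex.Gamma (-z j)‖) *
      (Real.exp (∑ j, (z j).re * (w j).re) * Real.exp (-∑ j, (w j).im * (z j).im)) := by
  rw [mellinTerm_eq, norm_mul, norm_prod, Complex.norm_exp, ← Real.exp_add, Complex.re_sum]
  congr 2
  rw [← sub_eq_add_neg, ← Finset.sum_sub_distrib]
  exact Finset.sum_congr rfl fun _ _ => by rw [Complex.mul_re]; ring

theorem columnForm_imagPoint (B : Matrix (Fin d) (Fin N) ℤ) (j : Fin N) (t : Fin d → ℝ) :
    columnForm B j (imagPoint t) = Complex.I * realForm B j t := by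
  simp only [columnForm, imagPoint, realForm, Complex.ofReal_sum, Complex.ofReal_mul,
    Complex.ofReal_intCast, Finset.mul_sum]
  exact Finset.sum_congr rfl fun _ _ => by ring

/-- The logarithms of the coordinates. -/
def logs (θ : Fin N → ℝ) (v : Fin N → ℂ) : Fin N → ℂ := fun j => branchLog (θ j) (v j)

theorem mbIntegrand_imagPoint (γ : Fin N → ℝ) (B : Matrix (Fin d) (Fin N) ℤ) (θ : Fin N → ℝ)
    (v : Fin N → ℂ) (t : Fin d → ℝ) :
    mbIntegrand γ B θ v (imagPoint t) = mellinTerm (mellinPoint γ B t) (logs θ v) := by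
  simp only [mbIntegrand, mellinTerm, mellinPoint, logs, columnForm_imagPoint, neg_add, sub_eq_add_neg]

theorem mbIntegral_eq (γ : Fin N → ℝ) (B : Matrix (Fin d) (Fin N) ℤ) (θ : Fin N → ℝ)
    (v : Fin N → ℂ) : mbIntegral γ B θ v = Complex.I ^ d * mellinIntegral γ B (logs θ v) := by
  simp only [mbIntegral, mellinIntegral, mbIntegrand_imagPoint]

@[simp]
theorem mellinPoint_re (γ : Fin N → ℝ) (B : Matrix (Fin d) (Fin N) ℤ) (t : Fin d → ℝ) (j : Fin N) :
    (mellinPoint γ B t j).re = γ j := by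
  simp [mellinPoint]

@[simp]
theorem mellinPoint_im (γ : Fin N → ℝ) (B : Matrix (Fin d) (Fin N) ℤ) (t : Fin d → ℝ) (j : Fin N) :
    (mellinPoint γ B t j).im = realForm B j t := by
  simp [mellinPoint]

@[fun_prop]
theorem continuous_mellinPoint (γ : Fin N → ℝ) (B : Matrix (Fin d) (Fin N) ℤ) :
    Continuous (mellinPoint γ B) := by
  unfold mellinPoint; fun_prop

theorem differentiableAt_Gamma_of_re_pos {z : ℂ} (hz : 0 < z.re) :
    DifferentiableAt ℂ Complex.Gamma z :=
  Complex.differentiableAt_Gamma z fun m h => by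
    have := congrArg Complex.re h
    simp at this
    have : (0 : ℝ) ≤ m := m.cast_nonneg
    linarith

theorem continuous_prod_Gamma {X : Type*} [TopologicalSpace X] {z : X → Fin N → ℂ}
    (hz : Continuous z) (hneg : ∀ x j, (z x j).re < 0) :
    Continuous fun x => ∏ j, Complex.Gamma (-z x j) := by
  refine continuous_finsetProd _ fun j _ => continuous_iff_continuousAt.2 fun x => ?_
  refine ContinuousAt.comp (g := Complex.Gamma) (f := fun x => -z x j)
    (differentiableAt_Gamma_of_re_pos (by simpa using hneg x j)).continuousAt ?_
  exact ((continuous_apply j).comp hz).neg.continuousAt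

theorem continuous_mellinTerm {X : Type*} [TopologicalSpace X] {z : X → Fin N → ℂ}
    (hz : Continuous z) (hneg : ∀ x j, (z x j).re < 0) (w : Fin N → ℂ) :
    Continuous fun x => mellinTerm (z x) w := by
  simp only [mellinTerm_eq]
  refine (continuous_prod_Gamma hz hneg).mul (Complex.continuous_exp.comp ?_)
  exact continuous_finsetSum _ fun j _ => ((continuous_apply j).comp hz).mul continuous_const

/-- Finitely many positive numbers lie in a compact subset of `(0, ∞)`. -/
theorem exists_forall_mem_Icc {x : Fin N → ℝ} (hx : ∀ j, 0 < x j) :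
    ∃ p q, 0 < p ∧ ∀ j, x j ∈ Set.Icc p q := by
  have h1 : ∀ᶠ p : ℝ in 𝓝[>] 0, ∀ j, p ≤ x j := eventually_all.2 fun j =>
    nhdsWithin_le_nhds (tendsto_id.eventually_le_const (hx j))
  obtain ⟨p, hp, hp0⟩ := (h1.and self_mem_nhdsWithin).exists
  have h2 : ∀ᶠ q : ℝ in atTop, ∀ j, x j ≤ q := eventually_all.2 fun j => eventually_ge_atTop _
  obtain ⟨q, hq⟩ := h2.exists
  exact ⟨p, q, hp0, fun j => ⟨hp j, hq j⟩⟩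

variable {B : Matrix (Fin d) (Fin N) ℤ}

/-- The rate `φ` is the midpoint of `(π/2)ρ` and `π/2`: the Gamma factors decay at rate `φ`, the
powers grow at rate at most `(π/2)ρ`, and the difference is `κ`. Uniformity in the real parts is
what permits moving the path of integration. -/
theorem exists_norm_mellinTerm_le {w : Fin N → ℂ} (hw : Admissible B fun j => (w j).im) {p q : ℝ}
    (hp : 0 < p) :
    ∃ C κ, 0 < C ∧ 0 < κ ∧ ∀ (z : Fin N → ℂ) (t : Fin d → ℝ),
      (∀ j, -(z j).re ∈ Set.Icc p q) → (∀ j, (z j).im = realForm B j t) →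
      ‖mellinTerm z w‖ ≤ C * Real.exp (-(κ * absSum B t)) := by
  obtain ⟨ρ, h0, h1, h⟩ := hw
  have hpi := Real.pi_pos
  set φ := Real.pi / 2 * ((1 + ρ) / 2) with hφ
  obtain ⟨C, hC, hG⟩ := exists_norm_Gamma_le (q := q) hp (φ := φ) (by positivity) (by
    have : (1 + ρ) / 2 < 1 := by linarith
    exact mul_lt_of_lt_one_right (by positivity) this)
  have hκ : 0 < 1 - ρ := by linarith
  refine ⟨C ^ N * Real.exp (∑ j, |q| * |(w j).re|), Real.pi / 2 * ((1 - ρ) / 2), by positivity,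
    by positivity, fun z t hre him => ?_⟩
  rw [norm_mellinTerm]
  have e1 : ∏ j, ‖Complex.Gamma (-z j)‖ ≤ C ^ N * Real.exp (-(φ * absSum B t)) := by
    calc ∏ j, ‖Complex.Gamma (-z j)‖ ≤ ∏ j, (C * Real.exp (-(φ * |realForm B j t|))) := by
          refine Finset.prod_le_prod (fun _ _ => norm_nonneg _) fun j _ => ?_
          have := hG (-z j) (by simpa using hre j)
          simpa [him] using this
      _ = _ := by
          rw [Finset.prod_mul_distrib, ← Real.exp_sum]
          simp [absSum, Finset.mul_sum]
  have e2 : ∑ j, (z j).re * (w j).re ≤ ∑ j, |q| * |(w j).re| := by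
    refine Finset.sum_le_sum fun j _ => (le_abs_self _).trans ?_
    rw [abs_mul]
    have := hre j
    refine mul_le_mul_of_nonneg_right ?_ (abs_nonneg _)
    rw [abs_of_nonpos (by linarith [this.1])]
    exact this.2.trans (le_abs_self q)
  have e3 : -∑ j, (w j).im * (z j).im ≤ Real.pi / 2 * ρ * absSum B t := by
    simp only [him]
    exact (neg_le_abs _).trans (h t)
  calc _ ≤ C ^ N * Real.exp (-(φ * absSum B t)) *
        (Real.exp (∑ j, |q| * |(w j).re|) * Real.exp (Real.pi / 2 * ρ * absSum B t)) := by
        gcongr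
    _ = C ^ N * Real.exp (∑ j, |q| * |(w j).re|) *
        (Real.exp (-(φ * absSum B t)) * Real.exp (Real.pi / 2 * ρ * absSum B t)) := by ring
    _ = _ := by
        rw [← Real.exp_add, hφ]
        congr 2
        ring

variable {γ : Fin N → ℝ} {R : Matrix (Fin N) (Fin d) ℤ}

theorem integrable_mellinTerm (hR : B * R = 1) (hγ : ∀ j, γ j < 0) {w : Fin N → ℂ}
    (hw : Admissible B fun j => (w j).im) :
    Integrable fun t => mellinTerm (mellinPoint γ B t) w := by
  obtain ⟨p, q, hp, hpq⟩ := exists_forall_mem_Icc (x := fun j => -γ j) (fun j => by linarith [hγ j])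
  obtain ⟨C, κ, -, hκ, h⟩ := exists_norm_mellinTerm_le hw (q := q) hp
  refine ((integrable_exp_neg_mul_absSum hR hκ).const_mul C).mono' ?_
    (Eventually.of_forall fun t => h _ t (by simpa using hpq) (by simp))
  exact (continuous_mellinTerm (by fun_prop) (by simpa using hγ) w).aestronglyMeasurable

/-! ### Derivatives of the integral in logarithmic coordinates -/

/-- The linear form `w ↦ ∑ z_j w_j`. -/
def pairing (z : Fin N → ℂ) : (Fin N → ℂ) →L[ℂ] ℂ :=
  ∑ j, z j • ContinuousLinearMap.proj j

theorem pairing_apply (z w : Fin N → ℂ) : pairing z w = ∑ j, z j * w j := by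
  simp [pairing]

theorem norm_pairing_le (z : Fin N → ℂ) : ‖pairing z‖ ≤ ∑ j, ‖z j‖ := by
  refine ContinuousLinearMap.opNorm_le_bound _ (by positivity) fun w => ?_
  rw [pairing_apply, Finset.sum_mul]
  refine (norm_sum_le _ _).trans (Finset.sum_le_sum fun j _ => ?_)
  rw [norm_mul]
  gcongr
  exact norm_le_pi_norm w j

theorem continuous_pairing : Continuous (pairing (N := N)) := by
  unfold pairing
  fun_prop

theorem norm_pairing_mellinPoint_le (γ : Fin N → ℝ) (t : Fin d → ℝ) :
    ‖pairing (mellinPoint γ B t)‖ ≤ ∑ j, |γ j| + absSum B t := by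
  refine (norm_pairing_le _).trans ?_
  rw [absSum, ← Finset.sum_add_distrib]
  refine Finset.sum_le_sum fun j _ => (norm_add_le _ _).trans ?_
  simp

/-- The norm of the form `pairing (mellinPoint γ B t)` is at most a constant plus `absSum B t`, so
half of the decay rate pays for the exponential moment and half ensures integrability. -/
theorem analyticAt_mellinIntegral (hR : B * R = 1) (hγ : ∀ j, γ j < 0) {w : Fin N → ℂ}
    (hw : Admissible B fun j => (w j).im) :
    AnalyticAt ℂ (mellinIntegral γ B) w ∧ ∀ v, fderiv ℂ (mellinIntegral γ B) w v =
      ∫ t, mellinTerm (mellinPoint γ B t) w * ∑ j, mellinPoint γ B t j * v j := by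
  obtain ⟨p, q, hp, hpq⟩ := exists_forall_mem_Icc (x := fun j => -γ j) (fun j => by linarith [hγ j])
  obtain ⟨C, κ, hC, hκ, h⟩ := exists_norm_mellinTerm_le hw (q := q) hp
  have hcont := continuous_prod_Gamma (continuous_mellinPoint γ B) (by simpa using hγ)
  have hpair := (continuous_pairing (N := N)).comp (continuous_mellinPoint γ B)
  have key := analyticAt_integral_exp (μ := volume) (ρ := κ / 2)
    (G := fun t => ∏ j, Complex.Gamma (-mellinPoint γ B t j))
    (ℓ := fun t => pairing (mellinPoint γ B t)) hcont.aestronglyMeasurable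
    hpair.aestronglyMeasurable (half_pos hκ) w ?_
  · simp only [pairing_apply, ← mellinTerm_eq] at key
    exact key
  · simp only [pairing_apply, ← mellinTerm_eq]
    refine ((integrable_exp_neg_mul_absSum hR (half_pos hκ)).const_mul
      (C * Real.exp (κ / 2 * ∑ j, |γ j|))).mono' ?_ (Eventually.of_forall fun t => ?_)
    · refine Continuous.aestronglyMeasurable ?_
      exact (continuous_mellinTerm (continuous_mellinPoint γ B) (by simpa using hγ) w).norm.mul
        (Real.continuous_exp.comp (continuous_const.mul hpair.norm))
    · rw [Real.norm_of_nonneg (by positivity)]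
      have h2 := norm_pairing_mellinPoint_le (B := B) γ t
      calc _ ≤ C * Real.exp (-(κ * absSum B t)) *
            Real.exp (κ / 2 * (∑ j, |γ j| + absSum B t)) := by
            gcongr
            exact h _ t (by simpa using hpq) (by simp)
        _ = C * Real.exp (κ / 2 * ∑ j, |γ j|) *
            (Real.exp (-(κ * absSum B t)) * Real.exp (κ / 2 * absSum B t)) := by
            rw [mul_add, Real.exp_add]; ring
        _ = _ := by
            rw [← Real.exp_add]
            congr 2
            ring

/-- This is `Γ(1 - z_j) = -z_j Γ(-z_j)`. The factor `z_j` produced by differentiating in `w_j` is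
thereby exchanged for a unit shift of the exponent. -/
theorem mellinTerm_mul (z w : Fin N → ℂ) (j : Fin N) (hz : z j ≠ 0) :
    mellinTerm z w * z j = -(mellinTerm (z - Pi.single j 1) w * Complex.exp (w j)) := by
  have h1 : (z - Pi.single j 1 : Fin N → ℂ) j = z j - 1 := by simp
  have hne : ∀ i, i ≠ j → (z - Pi.single j 1 : Fin N → ℂ) i = z i := fun i hi => by
    simp [Pi.single_eq_of_ne hi]
  generalize (z - Pi.single j 1 : Fin N → ℂ) = u at h1 hne
  have e : ∏ i ∈ Finset.univ.erase j, (Complex.Gamma (-u i) * Complex.exp (u i * w i))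
      = ∏ i ∈ Finset.univ.erase j, (Complex.Gamma (-z i) * Complex.exp (z i * w i)) :=
    Finset.prod_congr rfl fun i hi => by rw [hne i (Finset.ne_of_mem_erase hi)]
  have h2 : Complex.Gamma (-(z j - 1)) = -z j * Complex.Gamma (-z j) := by
    rw [← Complex.Gamma_add_one _ (neg_ne_zero.2 hz)]
    congr 1; ring
  have h3 : Complex.exp (z j * w j) = Complex.exp ((z j - 1) * w j) * Complex.exp (w j) := by
    rw [← Complex.exp_add]; congr 1; ring
  rw [mellinTerm, mellinTerm, ← Finset.mul_prod_erase _ _ (Finset.mem_univ j),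
    ← Finset.mul_prod_erase _ (fun i => Complex.Gamma (-u i) * Complex.exp (u i * w i))
      (Finset.mem_univ j), e, h1, h2, h3]
  ring

theorem mellinPoint_sub_single (γ : Fin N → ℝ) (t : Fin d → ℝ) (j : Fin N) :
    mellinPoint (γ - Pi.single j 1) B t = mellinPoint γ B t - Pi.single j 1 := by
  ext i
  rcases eq_or_ne i j with rfl | h
  · simp [mellinPoint]; ring
  · simp [mellinPoint, Pi.single_eq_of_ne h]

theorem fderiv_mellinIntegral_single (hR : B * R = 1) (hγ : ∀ j, γ j < 0) {w : Fin N → ℂ}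
    (hw : Admissible B fun j => (w j).im) (j : Fin N) :
    fderiv ℂ (mellinIntegral γ B) w (Pi.single j 1)
      = -(mellinIntegral (γ - Pi.single j 1) B w * Complex.exp (w j)) := by
  rw [(analyticAt_mellinIntegral hR hγ hw).2, mellinIntegral, ← integral_mul_const, ← integral_neg]
  congr with t
  have hz : mellinPoint γ B t j ≠ 0 := fun h => by
    have := congrArg Complex.re h
    simp at this
    linarith [hγ j]
  rw [mellinPoint_sub_single, ← mellinTerm_mul _ _ _ hz]
  simp [Pi.single_apply]

/-! #### Translation of the path of integration -/

/-- Translate the path by `ζ m` with `ζ` complex. The integral is holomorphic in `ζ` on the strip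
where all real parts stay negative, so that no pole is met, and it does not depend on `Im ζ`, since
an imaginary translation is a substitution in `t`. Hence it is constant on the strip, which contains
`0` and `1`. -/
theorem mellinIntegral_add_realForm (hR : B * R = 1) (hγ : ∀ j, γ j < 0) {w : Fin N → ℂ}
    (hw : Admissible B fun j => (w j).im) (m : Fin d → ℝ)
    (hγm : ∀ j, γ j + realForm B j m < 0) :
    mellinIntegral (fun j => γ j + realForm B j m) B w = mellinIntegral γ B w := by
  set z : ℂ → (Fin d → ℝ) → Fin N → ℂ := fun ζ t j =>
    γ j + ζ * realForm B j m + Complex.I * realForm B j t with hz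
  set H : ℂ → ℂ := fun ζ => ∫ t, mellinTerm (z ζ t) w with hH
  set U : Set ℂ := {ζ | ∀ j, γ j + ζ.re * realForm B j m < 0} with hU
  have hre : ∀ ζ t j, (z ζ t j).re = γ j + ζ.re * realForm B j m := by simp [hz]
  have him : ∀ ζ t j, (z ζ t j).im = realForm B j (t + ζ.im • m) := fun ζ t j => by
    rw [realForm_add, realForm_smul]; simp [hz]; ring
  have hUo : IsOpen U := by
    simp only [hU, Set.ofPred_forall]
    exact isOpen_iInter_of_finite fun j => isOpen_lt (by fun_prop) continuous_const
  have hUc : Convex ℝ U := by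
    intro x hx y hy a b ha hb hab j
    have h1 := hx j
    have h2 := hy j
    have : γ j + (a • x + b • y).re * realForm B j m
        = a * (γ j + x.re * realForm B j m) + b * (γ j + y.re * realForm B j m) := by
      simp; linear_combination -(γ j) * hab
    rw [this]
    rcases ha.eq_or_lt with rfl | ha
    · rw [zero_add] at hab; subst hab; simpa using h2
    · nlinarith
  have hcont : ∀ ζ ∈ U, Continuous fun t => mellinTerm (z ζ t) w := fun ζ hζ =>
    continuous_mellinTerm (by simp only [hz]; fun_prop) (fun t j => by rw [hre]; exact hζ j) w
  have hdiff : ∀ ζ ∈ U, DifferentiableAt ℂ H ζ := by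
    intro ζ hζ
    obtain ⟨p, q, hp, hpq⟩ := exists_forall_mem_Icc
      (x := fun j => -(γ j + ζ.re * realForm B j m)) (fun j => by linarith [hζ j])
    -- Within distance `ε` of `ζ` the real parts move by at most `p/2`; the `+ 1` avoids a zero
    -- denominator.
    set ε : ℝ := p / 2 / (absSum B m + 1) with hε
    have hS := absSum_nonneg B m
    have hε0 : 0 < ε := by positivity
    obtain ⟨C, κ, hC, hκ, h⟩ := exists_norm_mellinTerm_le hw (q := q + p / 2) (half_pos hp)
    have hball : ∀ z' ∈ Metric.ball ζ ε, ∀ j,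
        -(γ j + z'.re * realForm B j m) ∈ Set.Icc (p / 2) (q + p / 2) := by
      intro z' hz' j
      have h1 : |(z'.re - ζ.re) * realForm B j m| ≤ p / 2 := by
        rw [abs_mul]
        have h2 : |z'.re - ζ.re| ≤ ε := by
          rw [Metric.mem_ball, dist_eq_norm] at hz'
          exact (Complex.abs_re_le_norm (z' - ζ)).trans hz'.le
        calc _ ≤ ε * (absSum B m + 1) := by
              gcongr
              linarith [abs_realForm_le_absSum B j m]
          _ = p / 2 := by rw [hε]; field_simp
      have := abs_le.1 h1
      have h3 := hpq j
      constructor <;> nlinarith [h3.1, h3.2]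
    refine differentiableAt_integral_of_bound hε0
      (bound := fun t => C * Real.exp (κ * ((|ζ.im| + ε) * absSum B m)) *
        Real.exp (-(κ * absSum B t))) (fun z' hz' => ?_) (fun t => ?_) (fun t z' hz' => ?_)
      ((integrable_exp_neg_mul_absSum hR hκ).const_mul _)
    · exact (hcont z' fun j => by linarith [(hball z' hz' j).1]).aestronglyMeasurable
    · intro z' hz'
      refine DifferentiableAt.differentiableWithinAt ?_
      simp only [mellinTerm]
      refine DifferentiableAt.fun_finsetProd fun j _ => ?_
      have h4 : DifferentiableAt ℂ (fun ζ => z ζ t j) z' := by simp only [hz]; fun_prop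
      refine DifferentiableAt.mul ?_ (h4.mul_const _).cexp
      refine DifferentiableAt.comp (g := Complex.Gamma) z'
        (differentiableAt_Gamma_of_re_pos ?_) h4.neg
      rw [Complex.neg_re, hre]
      linarith [(hball z' hz' j).1]
    · refine (h _ (t + z'.im • m) (fun j => by rw [hre]; exact hball z' hz' j)
        (him z' t)).trans ?_
      rw [mul_assoc, ← Real.exp_add]
      gcongr
      -- The imaginary part of the parameter only displaces `t` by a bounded amount, which costs a
      -- constant factor.
      have h5 : absSum B t ≤ absSum B (t + z'.im • m) + |z'.im| * absSum B m := by
        rw [← absSum_smul, absSum, absSum, absSum, ← Finset.sum_add_distrib]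
        refine Finset.sum_le_sum fun j _ => ?_
        have := abs_sub (realForm B j (t + z'.im • m)) (realForm B j (z'.im • m))
        rwa [realForm_add, add_sub_cancel_right, ← realForm_add] at this
      have h6 : |z'.im| ≤ |ζ.im| + ε := by
        rw [Metric.mem_ball, dist_eq_norm] at hz'
        have := (Complex.abs_im_le_norm (z' - ζ)).trans hz'.le
        rw [Complex.sub_im] at this
        linarith [abs_sub_abs_le_abs_sub z'.im ζ.im]
      have h7 : |z'.im| * absSum B m ≤ (|ζ.im| + ε) * absSum B m := by gcongr
      nlinarith
  have hinv : ∀ ζ (u : ℝ), H (ζ + u * Complex.I) = H ζ := by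
    intro ζ u
    simp only [hH]
    rw [← integral_add_right_eq_self (fun t => mellinTerm (z ζ t) w) (u • m)]
    congr with t
    congr 1
    ext j
    simp only [hz, realForm_add, realForm_smul, Complex.ofReal_add, Complex.ofReal_mul]
    ring
  have hderiv : U.EqOn (deriv H) 0 := by
    intro ζ hζ
    -- Differentiating the constant function `u ↦ H(ζ + iu)` gives `H'(ζ)·i = 0`.
    have h1 : HasDerivAt (fun u : ℝ => ζ + u * Complex.I) Complex.I 0 := by
      simpa using ((Complex.ofRealCLM.hasDerivAt (x := (0 : ℝ))).mul_const Complex.I).const_add ζ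
    have h2 : HasDerivAt H (deriv H ζ) (ζ + ((0 : ℝ) : ℂ) * Complex.I) := by
      simpa using (hdiff ζ hζ).hasDerivAt
    have h3 := h2.comp (0 : ℝ) h1
    have h4 : (H ∘ fun u : ℝ => ζ + u * Complex.I) = fun _ => H ζ := funext fun u => hinv ζ u
    rw [h4] at h3
    have := h3.unique (hasDerivAt_const (0 : ℝ) (H ζ))
    simpa using this
  have h01 : H 1 = H 0 :=
    hUo.is_const_of_deriv_eq_zero hUc.isPreconnected
      (fun ζ hζ => (hdiff ζ hζ).differentiableWithinAt) hderiv
      (by simpa [hU] using hγm) (by simpa [hU] using hγ)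
  have e1 : ∀ t, z 1 t = mellinPoint (fun j => γ j + realForm B j m) B t := fun t => by
    ext j; simp [hz, mellinPoint]
  have e0 : ∀ t, z 0 t = mellinPoint γ B t := fun t => by
    ext j; simp [hz, mellinPoint]
  simp only [hH, e1, e0] at h01
  exact h01

/-! #### Divergence -/

/-- If the inequality failed at `t`, the lower bound for `Γ` with `φ` close to `π/2` would keep the
integrand above a positive constant on an open cone containing `-t`, a set of infinite measure. -/
theorem sum_mul_realForm_le_of_integrable (hd : 0 < d) (hγ : ∀ j, γ j < 0) {w : Fin N → ℂ}
    (hint : Integrable fun t => mellinTerm (mellinPoint γ B t) w) (t : Fin d → ℝ) :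
    ∑ j, (w j).im * realForm B j t ≤ Real.pi / 2 * absSum B t := by
  by_contra! hlt
  obtain ⟨φ, hφ, hφ0, hφ1⟩ : ∃ φ : ℝ, (Real.pi - φ) * absSum B t < ∑ j, (w j).im * realForm B j t ∧
      φ ∈ Set.Ico 0 (Real.pi / 2) := by
    have hlim : Tendsto (fun φ : ℝ => (Real.pi - φ) * absSum B t) (𝓝[<] (Real.pi / 2))
        (𝓝 ((Real.pi - Real.pi / 2) * absSum B t)) := by
      refine Tendsto.mono_left ?_ nhdsWithin_le_nhds
      exact Continuous.tendsto (by fun_prop) _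
    rw [sub_half] at hlim
    exact ((hlim.eventually_lt_const hlt).and (Ico_mem_nhdsLT (by positivity))).exists
  choose c hc hG using fun j => exists_le_norm_Gamma (σ := -γ j) (by linarith [hγ j]) hφ0 hφ1
  set s : Set (Fin d → ℝ) :=
    {t | (Real.pi - φ) * absSum B t + ∑ j, (w j).im * realForm B j t < 0} with hs
  have hso : IsOpen s := isOpen_lt (by fun_prop) continuous_const
  have hsn : s.Nonempty := by
    refine ⟨(-1 : ℝ) • t, ?_⟩
    simp only [hs, Set.mem_ofPred_eq, absSum_smul, realForm_smul]
    simp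
    linarith
  have hsc : ∀ x : ℝ, 0 < x → ∀ t ∈ s, x • t ∈ s := by
    intro x hx t ht
    simp only [hs, Set.mem_ofPred_eq, absSum_smul, realForm_smul, abs_of_pos hx] at ht ⊢
    have : (Real.pi - φ) * (x * absSum B t) + ∑ j, (w j).im * (x * realForm B j t)
        = x * ((Real.pi - φ) * absSum B t + ∑ j, (w j).im * realForm B j t) := by
      rw [mul_add, Finset.mul_sum]
      congr 1
      · ring
      · exact Finset.sum_congr rfl fun _ _ => by ring
    rw [this]
    exact mul_neg_of_pos_of_neg hx ht
  have htop := measure_cone_eq_top hd hso hsn hsc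
  set K : ℝ := (∏ j, c j) * Real.exp (∑ j, γ j * (w j).re) with hK
  have hK0 : 0 < K := mul_pos (Finset.prod_pos fun j _ => hc j) (Real.exp_pos _)
  have hfin := hint.measure_norm_ge_lt_top hK0
  refine (hfin.trans_le' (measure_mono fun t ht => ?_)).ne htop
  simp only [Set.mem_ofPred_eq, norm_mellinTerm, mellinPoint_re, mellinPoint_im]
  have h1 : (∏ j, c j) * Real.exp (-((Real.pi - φ) * absSum B t))
      ≤ ∏ j, ‖Complex.Gamma (-mellinPoint γ B t j)‖ := by
    calc _ = ∏ j, (c j * Real.exp (-((Real.pi - φ) * |realForm B j t|))) := by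
          rw [Finset.prod_mul_distrib, ← Real.exp_sum]
          simp [absSum, Finset.mul_sum]
      _ ≤ _ := by
          refine Finset.prod_le_prod (fun j _ => (mul_pos (hc j) (Real.exp_pos _)).le) fun j _ => ?_
          have := hG j (-mellinPoint γ B t j) (by simp)
          simpa using this
  have h2 : 1 ≤ Real.exp (-((Real.pi - φ) * absSum B t)) *
      Real.exp (-∑ j, (w j).im * realForm B j t) := by
    rw [← Real.exp_add]
    refine Real.one_le_exp ?_
    have : (Real.pi - φ) * absSum B t + ∑ j, (w j).im * realForm B j t < 0 := ht
    linarith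
  calc K = K * 1 := (mul_one _).symm
    _ ≤ K * (Real.exp (-((Real.pi - φ) * absSum B t)) *
      Real.exp (-∑ j, (w j).im * realForm B j t)) := by gcongr
    _ = ((∏ j, c j) * Real.exp (-((Real.pi - φ) * absSum B t))) *
      (Real.exp (∑ j, γ j * (w j).re) * Real.exp (-∑ j, (w j).im * realForm B j t)) := by
        rw [hK]; ring
    _ ≤ _ := by gcongr

end Mellin

/-! ### Branches of the logarithm -/

section BranchLog

open Complex

theorem exp_branchLog (θ : ℝ) {z : ℂ} (hz : z ≠ 0) : exp (branchLog θ z) = z := by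
  rw [branchLog, exp_add, exp_log (mul_ne_zero hz (exp_ne_zero _)), mul_assoc, ← exp_add]
  simp

theorem branchLog_add_two_pi (θ : ℝ) (n : ℤ) (z : ℂ) :
    branchLog (θ + 2 * Real.pi * n) z = branchLog θ z + n * (2 * Real.pi * I) := by
  have h : exp (-(((θ + 2 * Real.pi * n : ℝ) : ℂ) * I)) = exp (-(θ * I)) := by
    rw [exp_eq_exp_iff_exists_int]
    exact ⟨-n, by push_cast; ring⟩
  rw [branchLog, branchLog, h]
  push_cast
  ring

theorem branchLog_mul_exp (θ ψ x : ℝ) (hx : 0 < x) (h : |ψ - θ| < Real.pi) :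
    branchLog θ (x * exp (ψ * I)) = Real.log x + ψ * I := by
  have h1 : (x : ℂ) * exp (ψ * I) * exp (-(θ * I)) = x * exp ((ψ - θ : ℝ) * I) := by
    rw [mul_assoc, ← exp_add]; congr 2; push_cast; ring
  have h2 := abs_lt.1 h
  rw [branchLog, h1, log_ofReal_mul hx (exp_ne_zero _), log_exp (by simpa using h2.1)
    (by simpa using h2.2.le)]
  push_cast
  ring

theorem hasDerivAt_branchLog {θ : ℝ} {z : ℂ} (hz : z * exp (-(θ * I)) ∈ slitPlane) :
    HasDerivAt (branchLog θ) z⁻¹ z := by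
  have h1 : HasDerivAt (fun z : ℂ => z * exp (-(θ * I))) (exp (-(θ * I))) z := by
    simpa using (hasDerivAt_id z).mul_const (exp (-(θ * I)))
  have h2 := (h1.clog hz).add_const (θ * I)
  have h3 : exp (-(θ * I)) / (z * exp (-(θ * I))) = z⁻¹ := by
    rw [div_mul_cancel_right₀ (exp_ne_zero _)]
  rw [h3] at h2
  exact h2

theorem analyticAt_branchLog {θ : ℝ} {z : ℂ} (hz : z * exp (-(θ * I)) ∈ slitPlane) :
    AnalyticAt ℂ (branchLog θ) z :=
  ((analyticAt_id.mul analyticAt_const).clog hz).add analyticAt_const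

end BranchLog

/-! ### The Mellin–Barnes integral solves the system -/

section Solves

variable {r N d : ℕ} {B : Matrix (Fin d) (Fin N) ℤ} {R : Matrix (Fin N) (Fin d) ℤ}

/-- The points at which the Mellin–Barnes integral with arguments near `θ` is holomorphic. -/
def mbDomain (B : Matrix (Fin d) (Fin N) ℤ) (θ : Fin N → ℝ) : Set (Fin N → ℂ) :=
  {v | (∀ j, v j * Complex.exp (-(θ j * Complex.I)) ∈ Complex.slitPlane) ∧
    Admissible B fun j => (logs θ v j).im}

variable {θ : Fin N → ℝ} {v : Fin N → ℂ}

theorem analyticAt_logs (hv : ∀ j, v j * Complex.exp (-(θ j * Complex.I)) ∈ Complex.slitPlane) :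
    AnalyticAt ℂ (logs θ) v := by
  refine analyticAt_pi_iff.2 fun j => ?_
  exact AnalyticAt.comp (g := branchLog (θ j)) (f := fun v : Fin N → ℂ => v j)
    (analyticAt_branchLog (hv j)) ((ContinuousLinearMap.proj (R := ℂ) (φ := fun _ : Fin N => ℂ) j).analyticAt v)

theorem isOpen_mbDomain : IsOpen (mbDomain B θ) := by
  have h1 : IsOpen {v : Fin N → ℂ |
      ∀ j, v j * Complex.exp (-(θ j * Complex.I)) ∈ Complex.slitPlane} := by
    simp only [Set.ofPred_forall]
    exact isOpen_iInter_of_finite fun j => Complex.isOpen_slitPlane.preimage (by fun_prop)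
  have h2 : ContinuousOn (fun v j => (logs θ v j).im) {v : Fin N → ℂ |
      ∀ j, v j * Complex.exp (-(θ j * Complex.I)) ∈ Complex.slitPlane} := fun v hv => by
    refine ContinuousAt.continuousWithinAt (continuousAt_pi.2 fun j => ?_)
    exact Complex.continuous_im.continuousAt.comp
      ((continuous_apply j).continuousAt.comp (analyticAt_logs hv).continuousAt)
  exact h2.isOpen_inter_preimage h1 isOpen_admissible

theorem ne_zero_of_mem_mbDomain (hv : v ∈ mbDomain B θ) (j : Fin N) : v j ≠ 0 := fun h => by
  have := hv.1 j
  rw [h, zero_mul] at this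
  exact Complex.zero_notMem_slitPlane this

variable {γ : Fin N → ℝ}

theorem mbConverges_of_mem (hR : B * R = 1) (hγ : ∀ j, γ j < 0) (hv : v ∈ mbDomain B θ) :
    MBConverges γ B θ v := by
  simp only [MBConverges, mbIntegrand_imagPoint]
  exact integrable_mellinTerm hR hγ hv.2

theorem mbIntegral_eq_comp (γ : Fin N → ℝ) (B : Matrix (Fin d) (Fin N) ℤ) (θ : Fin N → ℝ) :
    mbIntegral γ B θ = fun v => Complex.I ^ d * mellinIntegral γ B (logs θ v) :=
  funext fun v => mbIntegral_eq γ B θ v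

theorem analyticAt_mbIntegral (hR : B * R = 1) (hγ : ∀ j, γ j < 0) (hv : v ∈ mbDomain B θ) :
    AnalyticAt ℂ (mbIntegral γ B θ) v := by
  rw [mbIntegral_eq_comp]
  exact analyticAt_const.mul ((analyticAt_mellinIntegral hR hγ hv.2).1.comp (analyticAt_logs hv.1))

theorem fderiv_logs_single
    (hv : ∀ j, v j * Complex.exp (-(θ j * Complex.I)) ∈ Complex.slitPlane) (j : Fin N) :
    fderiv ℂ (logs θ) v (Pi.single j 1) = (v j)⁻¹ • Pi.single j 1 := by
  have h : HasFDerivAt (logs θ) (ContinuousLinearMap.pi fun i =>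
      (v i)⁻¹ • (ContinuousLinearMap.proj i : (Fin N → ℂ) →L[ℂ] ℂ)) v := by
    refine hasFDerivAt_pi.2 fun i => ?_
    exact (hasDerivAt_branchLog (hv i)).comp_hasFDerivAt v
      (ContinuousLinearMap.proj (R := ℂ) (φ := fun _ : Fin N => ℂ) i).hasFDerivAt
  rw [h.fderiv]
  ext i
  rcases eq_or_ne i j with rfl | hij
  · simp
  · simp [Pi.single_eq_of_ne hij]

theorem pderiv_mbIntegral_eq_fderiv (hR : B * R = 1) (hγ : ∀ j, γ j < 0) (hv : v ∈ mbDomain B θ)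
    (j : Fin N) : pderiv j (mbIntegral γ B θ) v =
      Complex.I ^ d * ((v j)⁻¹ * fderiv ℂ (mellinIntegral γ B) (logs θ v) (Pi.single j 1)) := by
  have h1 := (analyticAt_mellinIntegral hR hγ hv.2).1.differentiableAt
  have h2 := (analyticAt_logs hv.1).differentiableAt
  rw [pderiv, mbIntegral_eq_comp]
  have h3 := (h1.hasFDerivAt.comp v h2.hasFDerivAt).const_mul (Complex.I ^ d)
  rw [Function.comp_def] at h3
  rw [h3.fderiv, smul_apply, ContinuousLinearMap.comp_apply,
    fderiv_logs_single hv.1, map_smul, smul_eq_mul, smul_eq_mul]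

/-- The factor `1/v_j` from the chain rule cancels the `exp(w_j)` of the logarithmic formula. The
shifted exponents are again negative, so the rule can be iterated on the same domain. -/
theorem pderiv_mbIntegral (hR : B * R = 1) (hγ : ∀ j, γ j < 0) (hv : v ∈ mbDomain B θ)
    (j : Fin N) :
    pderiv j (mbIntegral γ B θ) v = -mbIntegral (γ - Pi.single j 1) B θ v := by
  have h0 := ne_zero_of_mem_mbDomain hv j
  rw [pderiv_mbIntegral_eq_fderiv hR hγ hv, fderiv_mellinIntegral_single hR hγ hv.2, mbIntegral_eq]
  have : Complex.exp (logs θ v j) = v j := exp_branchLog _ h0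
  rw [this]
  field_simp

theorem pderiv_eqOn {s : Set (Fin N → ℂ)} (hs : IsOpen s) {Φ Ψ : (Fin N → ℂ) → ℂ}
    (h : s.EqOn Φ Ψ) (j : Fin N) : s.EqOn (pderiv j Φ) (pderiv j Ψ) := fun _ hv =>
  (pderiv_congr j (h.eventuallyEq_of_mem (hs.mem_nhds hv))).eq_of_nhds

theorem sub_single_neg (hγ : ∀ j, γ j < 0) {c : ℝ} (hc : 0 ≤ c) (i j : Fin N) :
    (γ - Pi.single i c : Fin N → ℝ) j < 0 := by
  have : (0 : ℝ) ≤ (Pi.single i c : Fin N → ℝ) j := by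
    rcases eq_or_ne j i with rfl | h
    · simpa
    · simp [Pi.single_eq_of_ne h]
  simp only [Pi.sub_apply]
  linarith [hγ j]

theorem pderiv_iterate_eqOn (hR : B * R = 1) (hγ : ∀ j, γ j < 0) {Φ : (Fin N → ℂ) → ℂ} {c : ℂ}
    (hΦ : (mbDomain B θ).EqOn Φ (c • mbIntegral γ B θ)) (j : Fin N) (n : ℕ) :
    (mbDomain B θ).EqOn ((pderiv j)^[n] Φ)
      ((c * (-1) ^ n) • mbIntegral (γ - Pi.single j (n : ℝ)) B θ) := by
  induction n with
  | zero => simpa using hΦ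
  | succ n ih =>
    rw [Function.iterate_succ_apply']
    intro v hv
    have hγ' := sub_single_neg hγ (Nat.cast_nonneg (α := ℝ) n) j
    rw [pderiv_eqOn isOpen_mbDomain ih j hv,
      (pderiv_smul j _ (analyticAt_mbIntegral hR hγ' hv)).eq_of_nhds, Pi.smul_apply, Pi.smul_apply,
      pderiv_mbIntegral hR hγ' hv, sub_sub, ← Pi.single_add]
    push_cast
    simp only [smul_eq_mul, pow_succ]
    ring

theorem pderivPow_mbIntegral (hR : B * R = 1) (hγ : ∀ j, γ j < 0) (k : Fin N → ℕ)
    (hv : v ∈ mbDomain B θ) :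
    pderivPow k (mbIntegral γ B θ) v
      = (-1) ^ (∑ j, k j) * mbIntegral (fun j => γ j - k j) B θ v := by
  have key : ∀ l : List (Fin N),
      (∀ j, (γ - (l.map fun i => (Pi.single i (k i : ℝ) : Fin N → ℝ)).sum) j < 0) ∧
      (mbDomain B θ).EqOn (l.foldr (fun j Ψ => (pderiv j)^[k j] Ψ) (mbIntegral γ B θ))
        (((-1 : ℂ) ^ (l.map k).sum) •
          mbIntegral (γ - (l.map fun i => (Pi.single i (k i : ℝ) : Fin N → ℝ)).sum) B θ) := by
    intro l
    induction l with
    | nil => exact ⟨by simpa using hγ, by simpa using Set.eqOn_refl _ _⟩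
    | cons j l ih =>
      have e : γ - (((j :: l).map fun i => (Pi.single i (k i : ℝ) : Fin N → ℝ)).sum)
          = γ - (l.map fun i => (Pi.single i (k i : ℝ) : Fin N → ℝ)).sum
            - Pi.single j (k j : ℝ) := by
        rw [List.map_cons, List.sum_cons]; abel
      refine ⟨fun i => ?_, ?_⟩
      · rw [e]
        exact sub_single_neg ih.1 (Nat.cast_nonneg _) j i
      · rw [e, List.map_cons, List.sum_cons, add_comm, pow_add, List.foldr_cons]
        exact pderiv_iterate_eqOn hR ih.1 ih.2 j (k j)
  have h := (key (List.finRange N)).2 hv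
  rw [pderivPow, h, ← Fin.sum_univ_def, ← Fin.sum_univ_def, Pi.smul_apply, smul_eq_mul]
  congr 2
  ext j
  simp [Finset.sum_apply, Pi.single_apply]

/-- In logarithmic coordinates the operator is the derivative in the direction `x`. It multiplies
the integrand by `∑ (γ_j + √-1 b_j·t) x_j`, which does not depend on `t` because `x` is orthogonal
to the rows of `B`. -/
theorem euler_mbIntegral (hR : B * R = 1) (hγ : ∀ j, γ j < 0) (hv : v ∈ mbDomain B θ)
    {x : Fin N → ℤ} (hx : ∀ k, ∑ j, B k j * x j = 0) :
    ∑ j, (x j : ℂ) * v j * pderiv j (mbIntegral γ B θ) v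
      = ((∑ j, γ j * x j : ℝ) : ℂ) * mbIntegral γ B θ v := by
  have h1 : ∀ t, ∑ j, mellinPoint γ B t j * (x j : ℂ) = ((∑ j, γ j * x j : ℝ) : ℂ) := fun t => by
    have h2 : ∑ j, realForm B j t * x j = 0 := by
      have := sum_mul_realForm (B := B) (fun j => (x j : ℝ)) t
      have h3 : ∀ k, ∑ j, (x j : ℝ) * (B k j : ℝ) = 0 := fun k => by
        have := hx k
        simp only [mul_comm (B k _)] at this
        exact_mod_cast this
      simp only [h3, zero_mul, Finset.sum_const_zero] at this
      simpa [mul_comm] using this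
    have h4 : ∑ j, (realForm B j t : ℂ) * (x j : ℂ) = 0 := by exact_mod_cast h2
    simp only [mellinPoint, add_mul, Finset.sum_add_distrib, mul_assoc, ← Finset.mul_sum, h4]
    push_cast
    ring
  have h5 : ∑ j, (x j : ℂ) * v j * pderiv j (mbIntegral γ B θ) v
      = Complex.I ^ d * fderiv ℂ (mellinIntegral γ B) (logs θ v) (fun j => (x j : ℂ)) := by
    have e : (fun j => (x j : ℂ)) = ∑ j, (x j : ℂ) • (Pi.single j 1 : Fin N → ℂ) := by
      ext i; simp [Finset.sum_apply, Pi.single_apply]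
    rw [e, map_sum, Finset.mul_sum]
    refine Finset.sum_congr rfl fun j _ => ?_
    have := ne_zero_of_mem_mbDomain hv j
    rw [pderiv_mbIntegral_eq_fderiv hR hγ hv, map_smul, smul_eq_mul]
    field_simp
  rw [h5, (analyticAt_mellinIntegral hR hγ hv.2).2]
  simp only [h1]
  rw [integral_mul_const, mbIntegral_eq, mellinIntegral]
  ring

theorem solvesAt_mbIntegral {a : Fin N → Fin r → ℤ} (ha : IsASet a) {α : Fin r → ℝ}
    (hB : IsBMatrix a B) (hR : B * R = 1) (hγ : ∀ j, γ j < 0)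
    (hγα : ∑ j, γ j • toReal (a j) = α) (hv : v ∈ mbDomain B θ) :
    SolvesAt a α (mbIntegral γ B θ) v where
  analyticAt := analyticAt_mbIntegral hR hγ hv
  euler i := by
    have h := euler_mbIntegral hR hγ hv (x := fun j => a j i) fun k => hB.sum_smul_eq_zero k i
    have h2 : ∑ j, γ j * ((a j i : ℤ) : ℝ) = α i := by
      rw [← hγα]; simp [toReal, Finset.sum_apply]
    rw [h, h2, sub_self]
  box l hl := by
    obtain ⟨m, hm⟩ := hB.exists_eq_sum hl
    rw [pderivPow_mbIntegral hR hγ _ hv, pderivPow_mbIntegral hR hγ _ hv]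
    have hpm : ∀ j, ((l j).toNat : ℤ) - ((-l j).toNat : ℤ) = l j := fun j => by omega
    have hdeg : ∑ j, (l j).toNat = ∑ j, (-l j).toNat := by
      have h0 := ha.sum_eq_zero hl
      rw [← Finset.sum_congr rfl fun j _ => hpm j, Finset.sum_sub_distrib] at h0
      have := sub_eq_zero.1 h0
      exact_mod_cast this
    have hform : ∀ j, realForm B j (fun k => (m k : ℝ)) = l j := fun j => by
      rw [realForm, hm]; push_cast; rfl
    have hneg : ∀ x : Fin N → ℕ, ∀ j, γ j - x j < 0 := fun x j => by
      have := Nat.cast_nonneg (α := ℝ) (x j)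
      linarith [hγ j]
    have he : (fun j => (γ j - ((l j).toNat : ℝ)) + realForm B j fun k => (m k : ℝ))
        = fun j => γ j - ((-l j).toNat : ℝ) := by
      ext j
      have : (((l j).toNat : ℝ)) - ((-l j).toNat : ℝ) = l j := by exact_mod_cast hpm j
      rw [hform]; linarith
    -- Lowering the exponents by the positive or by the negative part of `l` gives vectors that
    -- differ by `l`, which is the translation of the path by the integer point `m`.
    have key := mellinIntegral_add_realForm hR (hneg fun j => (l j).toNat) hv.2
      (fun k => (m k : ℝ)) (fun j => by
        rw [congrFun he j]; exact hneg (fun j => (-l j).toNat) j)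
    rw [hdeg, mbIntegral_eq, mbIntegral_eq, ← key, he, sub_self]

end Solves

/-! ### Determinations of the Mellin–Barnes integral -/

section Determinations

variable {r N d : ℕ} {B : Matrix (Fin d) (Fin N) ℤ} {R : Matrix (Fin N) (Fin d) ℤ}
  {γ : Fin N → ℝ}

theorem mellinTerm_add (z w x : Fin N → ℂ) :
    mellinTerm z (w + x) = mellinTerm z w * Complex.exp (∑ j, z j * x j) := by
  rw [mellinTerm_eq, mellinTerm_eq, mul_assoc, ← Complex.exp_add, ← Finset.sum_add_distrib]
  simp only [Pi.add_apply, mul_add]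

/-- The vector `2 π √-1 n`. -/
def twoPiI (n : Fin N → ℤ) : Fin N → ℂ := fun j => n j * (2 * Real.pi * Complex.I)

theorem sum_mellinPoint_mul_ofReal (γ : Fin N → ℝ) (t : Fin d → ℝ) (x : Fin N → ℝ) :
    ∑ j, mellinPoint γ B t j * (x j : ℂ) = ((∑ j, γ j * x j : ℝ) : ℂ) +
      Complex.I * ((∑ k, (∑ j, x j * (B k j : ℝ)) * t k : ℝ) : ℂ) := by
  rw [← sum_mul_realForm]
  push_cast
  rw [Finset.mul_sum, ← Finset.sum_add_distrib]
  exact Finset.sum_congr rfl fun j _ => by simp only [mellinPoint]; ring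

/-- A change of arguments acts on the integrand through a constant and a real character of `t` that
depends only on `Bn`. This governs both dependence and independence of determinations. -/
theorem mellinTerm_add_twoPiI (γ : Fin N → ℝ) (t : Fin d → ℝ) (w : Fin N → ℂ) (n : Fin N → ℤ) :
    mellinTerm (mellinPoint γ B t) (w + twoPiI n) =
      Complex.exp (2 * Real.pi * Complex.I * ((∑ j, γ j * n j : ℝ) : ℂ)) *
        (mellinTerm (mellinPoint γ B t) w *
          Complex.exp (-(2 * Real.pi * ((∑ k, (∑ j, (n j : ℝ) * (B k j : ℝ)) * t k : ℝ) : ℂ)))) := by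
  have h : ∑ j, mellinPoint γ B t j * twoPiI n j
      = 2 * Real.pi * Complex.I * ∑ j, mellinPoint γ B t j * ((n j : ℝ) : ℂ) := by
    rw [Finset.mul_sum]
    exact Finset.sum_congr rfl fun j _ => by simp only [twoPiI]; push_cast; ring
  rw [mellinTerm_add, h, sum_mellinPoint_mul_ofReal, mul_left_comm (Complex.exp _),
    ← Complex.exp_add]
  congr 2
  linear_combination (2 * Real.pi * ((∑ k, (∑ j, (n j : ℝ) * (B k j : ℝ)) * t k : ℝ) : ℂ)) *
    Complex.I_sq

theorem logs_add_two_pi (θ : Fin N → ℝ) (n : Fin N → ℤ) (v : Fin N → ℂ) :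
    logs (fun j => θ j + 2 * Real.pi * n j) v = logs θ v + twoPiI n :=
  funext fun j => branchLog_add_two_pi (θ j) (n j) (v j)

theorem twoPiI_im (n : Fin N → ℤ) (j : Fin N) : (twoPiI n j).im = 2 * Real.pi * n j := by
  simp [twoPiI, mul_comm]

theorem mbIntegral_add_two_pi_of_sum_eq_zero (γ : Fin N → ℝ) (θ : Fin N → ℝ) {n : Fin N → ℤ}
    (hn : ∀ k, ∑ j, (n j : ℝ) * (B k j : ℝ) = 0) :
    mbIntegral γ B (fun j => θ j + 2 * Real.pi * n j) =
      Complex.exp (2 * Real.pi * Complex.I * ((∑ j, γ j * n j : ℝ) : ℂ)) • mbIntegral γ B θ := by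
  ext v
  rw [Pi.smul_apply, mbIntegral_eq, mbIntegral_eq, logs_add_two_pi, mellinIntegral, mellinIntegral]
  simp only [mellinTerm_add_twoPiI, hn]
  rw [integral_const_mul, smul_eq_mul]
  simp only [zero_mul, Finset.sum_const_zero, Complex.ofReal_zero, mul_zero, neg_zero,
    Complex.exp_zero, mul_one]
  ring

theorem exists_eq_add_two_pi {υ : Fin N → ℂ} (hυ : ∀ j, υ j ≠ 0) {θ θ' : Fin N → ℝ}
    (hθ : ∀ j, υ j = (‖υ j‖ : ℂ) * Complex.exp (θ j * Complex.I))
    (hθ' : ∀ j, υ j = (‖υ j‖ : ℂ) * Complex.exp (θ' j * Complex.I)) :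
    ∃ n : Fin N → ℤ, ∀ j, θ' j = θ j + 2 * Real.pi * n j := by
  have h : ∀ j, ∃ n : ℤ, θ' j = θ j + 2 * Real.pi * n := fun j => by
    have h0 : (‖υ j‖ : ℂ) ≠ 0 := by simpa using hυ j
    have h1 := mul_left_cancel₀ h0 ((hθ' j).symm.trans (hθ j))
    obtain ⟨n, hn⟩ := Complex.exp_eq_exp_iff_exists_int.1 h1
    refine ⟨n, ?_⟩
    have := congrArg Complex.im hn
    simp at this
    rw [this]; ring
  choose n hn using h
  exact ⟨n, hn⟩

theorem logs_eq_of_arg {θ ψ : Fin N → ℝ} {x : Fin N → ℝ} (hx : ∀ j, 0 < x j)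
    (h : ∀ j, |ψ j - θ j| < Real.pi) :
    logs θ (fun j => x j * Complex.exp (ψ j * Complex.I))
      = fun j => (Real.log (x j) : ℂ) + ψ j * Complex.I :=
  funext fun j => branchLog_mul_exp (θ j) (ψ j) (x j) (hx j) (h j)

/-- Separation from the zonotope and convergence at a single point give weak inequalities that are
compatible on the boundary. Convergence nearby allows the arguments to turn by `δ` times the signs
of `b_j·t`, which adds `δ ∑ |b_j·t| > 0` and yields a contradiction. -/
theorem mem_zonotope_of_eventually_mbConverges (hd : 0 < d) (hR : B * R = 1)
    (hγ : ∀ j, γ j < 0) {υ : Fin N → ℂ} (hυ : ∀ j, υ j ≠ 0) {θ : Fin N → ℝ}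
    (hθ : ∀ j, υ j = (‖υ j‖ : ℂ) * Complex.exp (θ j * Complex.I))
    (hconv : ∀ᶠ v in 𝓝 υ, MBConverges γ B θ v) {τ : Fin d → ℝ}
    (hτ : ∀ k, ∑ j, θ j * (B k j : ℝ) = 2 * Real.pi * τ k) : τ ∈ zonotope B := by
  by_contra hnot
  obtain ⟨t, ht0, ht⟩ := exists_absSum_le_of_notMem_zonotope hR hnot
  set ψ : ℝ → Fin N → ℝ := fun δ j => θ j + δ * SignType.sign (realForm B j t) with hψ
  set p : ℝ → Fin N → ℂ := fun δ j => (‖υ j‖ : ℂ) * Complex.exp (ψ δ j * Complex.I) with hp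
  have hp0 : p 0 = υ := funext fun j => by simp [hp, hψ, ← hθ j]
  have hpc : Tendsto p (𝓝[>] 0) (𝓝 υ) := by
    refine Tendsto.mono_left ?_ nhdsWithin_le_nhds
    refine Continuous.tendsto' ?_ 0 υ hp0
    simp only [hp, hψ]
    fun_prop
  obtain ⟨δ, hδ, hδ0, hδ1⟩ :=
    ((hpc.eventually hconv).and (Ioo_mem_nhdsGT Real.pi_pos)).exists
  simp only [MBConverges, mbIntegrand_imagPoint] at hδ
  have hlog : logs θ (p δ) = fun j => (Real.log ‖υ j‖ : ℂ) + ψ δ j * Complex.I := by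
    refine logs_eq_of_arg (fun j => norm_pos_iff.2 (hυ j)) fun j => ?_
    have h1 : |((SignType.sign (realForm B j t) : SignType) : ℝ)| ≤ 1 := by
      rcases SignType.sign (realForm B j t) with _ | _ | _ <;> simp
    simp only [hψ, add_sub_cancel_left, abs_mul, abs_of_pos hδ0]
    nlinarith
  have h2 := sum_mul_realForm_le_of_integrable hd hγ hδ t
  have h3 : ∑ j, (logs θ (p δ) j).im * realForm B j t
      = ∑ j, θ j * realForm B j t + δ * absSum B t := by
    rw [hlog, absSum, Finset.mul_sum, ← Finset.sum_add_distrib]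
    refine Finset.sum_congr rfl fun j _ => ?_
    have := sign_mul_self (realForm B j t)
    simp only [hψ, Complex.add_im, Complex.ofReal_im, Complex.im_ofReal_mul, Complex.I_im]
    linear_combination δ * this
  have h4 : ∑ j, θ j * realForm B j t = 2 * Real.pi * ∑ k, τ k * t k := by
    rw [sum_mul_realForm, Finset.mul_sum]
    exact Finset.sum_congr rfl fun k _ => by rw [hτ]; ring
  rw [h3, h4] at h2
  have h5 := mul_pos hδ0 ht0
  nlinarith [Real.pi_pos]

/-! #### Linear independence -/

open scoped FourierTransform RealInnerProductSpace in
theorem eq_zero_of_forall_integral_mul_exp_eq_zero {g : (Fin d → ℝ) → ℂ} (hc : Continuous g)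
    (hi : Integrable g)
    (h : ∀ ξ : Fin d → ℝ, ∫ t, g t * Complex.exp (Complex.I * ((∑ k, ξ k * t k : ℝ) : ℂ)) = 0) :
    g = 0 := by
  -- Fourier inversion is applied on Euclidean space, with frequency `-2πξ` in the present
  -- normalisation; a vanishing transform is integrable.
  set f : EuclideanSpace ℝ (Fin d) → ℂ := fun v => g (WithLp.ofLp v) with hf
  have hmp := EuclideanSpace.volume_preserving_symm_measurableEquiv_toLp (Fin d)
  have hfc : Continuous f := hc.comp (PiLp.continuous_ofLp 2 _)
  have hfi : Integrable f :=
    (hmp.integrable_comp_emb (MeasurableEquiv.measurableEmbedding _)).2 hi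
  have hF : 𝓕 f = 0 := by
    ext ξ
    rw [Real.fourier_eq', Pi.zero_apply, ← h (fun k => -2 * Real.pi * ξ k),
      ← hmp.integral_comp (MeasurableEquiv.measurableEmbedding _)]
    congr with v
    rw [smul_eq_mul, mul_comm]
    congr 2
    rw [mul_comm]
    congr 2
    rw [PiLp.inner_apply, Finset.mul_sum]
    refine Finset.sum_congr rfl fun k _ => ?_
    simp
    ring
  have := hfc.fourierInv_fourier_eq hfi (by rw [hF]; exact integrable_zero _ _ _)
  rw [hF] at this
  ext t
  have h2 := congrFun this (WithLp.toLp 2 t)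
  rw [Real.fourierInv_eq'] at h2
  simpa [hf] using h2.symm

/-- Dedekind's independence of characters, for homomorphisms from the additive group `ℝ^d` to `ℂ`.
They are distinguished on unit vectors because the real exponential is injective. -/
theorem eq_zero_of_forall_sum_mul_exp_eq_zero {D : ℕ} {κ : Fin D → Fin d → ℤ}
    (hκ : Function.Injective κ) {c : Fin D → ℂ}
    (h : ∀ t : Fin d → ℝ, ∑ i, c i *
      Complex.exp (-(2 * Real.pi * ((∑ k, (κ i k : ℝ) * t k : ℝ) : ℂ))) = 0) (i : Fin D) :
    c i = 0 := by
  let χ : Fin D → Multiplicative (Fin d → ℝ) →* ℂ := fun i =>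
    { toFun := fun t =>
        Complex.exp (-(2 * Real.pi * ((∑ k, (κ i k : ℝ) * t.toAdd k : ℝ) : ℂ)))
      map_one' := by simp
      map_mul' := fun t u => by
        rw [← Complex.exp_add]
        congr 1
        simp only [toAdd_mul, Pi.add_apply, mul_add, Finset.sum_add_distrib]
        push_cast
        ring }
  have hχ : Function.Injective χ := by
    intro i j hij
    refine hκ (funext fun k => ?_)
    have h1 := DFunLike.congr_fun hij (Multiplicative.ofAdd (Pi.single k 1))
    have h2 : ∀ i, χ i (Multiplicative.ofAdd (Pi.single k 1))
        = ((Real.exp (-(2 * Real.pi * (κ i k : ℝ))) : ℝ) : ℂ) := fun i => by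
      simp [χ, Pi.single_apply, apply_ite Complex.ofReal]
    rw [h2, h2] at h1
    have h3 := Real.exp_injective (Complex.ofReal_injective h1)
    have h4 : (κ i k : ℝ) = κ j k := by
      have := Real.pi_pos
      have h5 : 2 * Real.pi * (κ i k : ℝ) = 2 * Real.pi * κ j k := neg_injective h3
      exact mul_left_cancel₀ (by positivity) h5
    exact_mod_cast h4
  have hli := (linearIndependent_monoidHom (Multiplicative (Fin d → ℝ)) ℂ).comp χ hχ
  refine Fintype.linearIndependent_iff.1 hli c ?_ i
  ext t
  have := h t.toAdd
  simpa [Finset.sum_apply, χ] using this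

/-- The relation continues analytically to a convex tube containing all real translates of `w₀`.
Along these it says that the Fourier transform of the combined integrand vanishes, so the relation
holds pointwise in `t`. Dividing by the nowhere vanishing `mellinTerm` leaves a relation between
distinct characters. -/
theorem eq_zero_of_eventually_sum_mellinIntegral_eq_zero (hR : B * R = 1) (hγ : ∀ j, γ j < 0)
    {D : ℕ} {n : Fin D → Fin N → ℤ} {κ : Fin D → Fin d → ℤ} (hκ : Function.Injective κ)
    (hn : ∀ i k, ∑ j, (n i j : ℝ) * (B k j : ℝ) = κ i k) {w₀ : Fin N → ℂ}
    (hw : ∀ i, Admissible B fun j => ((w₀ + twoPiI (n i)) j).im) {c : Fin D → ℂ}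
    (h : ∀ᶠ w in 𝓝 w₀, ∑ i, c i * mellinIntegral γ B (w + twoPiI (n i)) = 0) (i : Fin D) :
    c i = 0 := by
  choose δ' hδ' hadm using fun i => (hw i).exists_forall_near
  obtain ⟨δ, hδ, hδ0⟩ : ∃ δ : ℝ, (∀ i, δ ≤ δ' i) ∧ 0 < δ := by
    have h1 : ∀ᶠ δ : ℝ in 𝓝[>] 0, ∀ i, δ ≤ δ' i := eventually_all.2 fun i =>
      nhdsWithin_le_nhds (tendsto_id.eventually_le_const (hδ' i))
    exact (h1.and self_mem_nhdsWithin).exists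
  set U : Set (Fin N → ℂ) := {w | ∀ j, |(w j).im - (w₀ j).im| < δ} with hU
  have hUc : Convex ℝ U := by
    intro x hx y hy a b ha hb hab j
    have h1 := abs_lt.1 (hx j)
    have h2 := abs_lt.1 (hy j)
    have e : ((a • x + b • y) j).im - (w₀ j).im
        = a * ((x j).im - (w₀ j).im) + b * ((y j).im - (w₀ j).im) := by
      simp; linear_combination (w₀ j).im * hab
    have := (convex_Ioo (-δ) δ) ⟨h1.1, h1.2⟩ ⟨h2.1, h2.2⟩ ha hb hab
    rw [e]
    exact abs_lt.2 ⟨this.1, this.2⟩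
  have hUadm : ∀ w ∈ U, ∀ i, Admissible B fun j => ((w + twoPiI (n i)) j).im := fun w hw i =>
    hadm i _ fun j => by
      simp only [Pi.add_apply, Complex.add_im, add_sub_add_right_eq_sub]
      exact (hw j).trans_le (hδ i)
  have han : AnalyticOnNhd ℂ (fun w => ∑ i, c i * mellinIntegral γ B (w + twoPiI (n i))) U :=
    fun w hw => Finset.analyticAt_fun_sum _ fun i _ => analyticAt_const.mul
      (AnalyticAt.comp (g := mellinIntegral γ B) (f := fun w => w + twoPiI (n i))
        (analyticAt_mellinIntegral hR hγ (hUadm w hw i)).1 (analyticAt_id.add analyticAt_const))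
  have hzero := han.eqOn_zero_of_preconnected_of_eventuallyEq_zero hUc.isPreconnected
    (z₀ := w₀) (fun j => by simpa using hδ0) h
  set g : (Fin d → ℝ) → ℂ := fun t =>
    ∑ i, c i * mellinTerm (mellinPoint γ B t) (w₀ + twoPiI (n i)) with hg
  have hgc : Continuous g := continuous_finsetSum _ fun i _ => continuous_const.mul
    (continuous_mellinTerm (continuous_mellinPoint γ B) (by simpa using hγ) _)
  have hgi : Integrable g := integrable_finsetSum _ fun i _ =>
    (integrable_mellinTerm hR hγ (hw i)).const_mul _
  have hg0 : g = 0 := by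
    refine eq_zero_of_forall_integral_mul_exp_eq_zero hgc hgi fun ξ => ?_
    -- The right inverse supplies a real translation with `Bx = ξ`, so every frequency is reached.
    set x : Fin N → ℝ := fun j => ∑ k, (R j k : ℝ) * ξ k with hx
    have hxB : ∀ k, ∑ j, x j * (B k j : ℝ) = ξ k := fun k => by
      have h1 : ∀ k', ∑ j, (B k j : ℝ) * R j k' = if k = k' then 1 else 0 := fun k' => by
        have := congrFun (congrFun hR k) k'
        rw [Matrix.mul_apply, Matrix.one_apply] at this
        exact_mod_cast this
      have h2 : ∑ j, x j * (B k j : ℝ) = ∑ k', (∑ j, (B k j : ℝ) * R j k') * ξ k' := by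
        simp only [hx, Finset.sum_mul]
        rw [Finset.sum_comm]
        exact Finset.sum_congr rfl fun _ _ => Finset.sum_congr rfl fun _ _ => by ring
      simp [h2, h1]
    have hmem : (w₀ + fun j => (x j : ℂ)) ∈ U := fun j => by simpa using hδ0
    have h3 := hzero hmem
    have h4 : ∀ i, mellinIntegral γ B ((w₀ + fun j => (x j : ℂ)) + twoPiI (n i))
        = Complex.exp ((∑ j, γ j * x j : ℝ) : ℂ) *
          ∫ t, mellinTerm (mellinPoint γ B t) (w₀ + twoPiI (n i)) *
            Complex.exp (Complex.I * ((∑ k, ξ k * t k : ℝ) : ℂ)) := fun i => by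
      rw [mellinIntegral, ← integral_const_mul]
      congr with t
      rw [add_right_comm, mellinTerm_add, sum_mellinPoint_mul_ofReal, Complex.exp_add]
      simp only [hxB]
      ring
    have hint : ∀ i, Integrable fun t =>
        c i * mellinTerm (mellinPoint γ B t) (w₀ + twoPiI (n i)) *
          Complex.exp (Complex.I * ((∑ k, ξ k * t k : ℝ) : ℂ)) := fun i => by
      refine (((integrable_mellinTerm hR hγ (hw i)).const_mul (c i)).norm).mono' ?_
        (Eventually.of_forall fun t => ?_)
      · refine Continuous.aestronglyMeasurable ?_
        exact (continuous_const.mul (continuous_mellinTerm (continuous_mellinPoint γ B)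
          (by simpa using hγ) _)).mul (by fun_prop)
      · rw [norm_mul, mul_comm Complex.I, Complex.norm_exp_ofReal_mul_I, mul_one]
    simp only [hg, Finset.sum_mul]
    rw [integral_finsetSum _ fun i _ => hint i]
    simp only [h4, Pi.zero_apply, mul_left_comm (c _)] at h3
    rw [← Finset.mul_sum] at h3
    have h5 := (mul_eq_zero.1 h3).resolve_left (Complex.exp_ne_zero _)
    simpa only [mul_assoc, integral_const_mul] using h5
  have hne : ∀ t, mellinTerm (mellinPoint γ B t) w₀ ≠ 0 := fun t => by
    refine Finset.prod_ne_zero_iff.2 fun j _ => mul_ne_zero ?_ (Complex.exp_ne_zero _)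
    exact Complex.Gamma_ne_zero_of_re_pos (by simpa using hγ j)
  have hsum : ∀ t : Fin d → ℝ, ∑ i,
      (c i * Complex.exp (2 * Real.pi * Complex.I * ((∑ j, γ j * n i j : ℝ) : ℂ))) *
      Complex.exp (-(2 * Real.pi * ((∑ k, (κ i k : ℝ) * t k : ℝ) : ℂ))) = 0 := fun t => by
    have h6 := congrFun hg0 t
    simp only [hg, mellinTerm_add_twoPiI, hn, Pi.zero_apply] at h6
    refine (mul_eq_zero.1 ?_).resolve_left (hne t)
    rw [Finset.mul_sum, ← h6]
    exact Finset.sum_congr rfl fun i _ => by ring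
  exact (mul_eq_zero.1 (eq_zero_of_forall_sum_mul_exp_eq_zero hκ hsum i)).resolve_right
    (Complex.exp_ne_zero _)

end Determinations

/-! ### Mellin–Barnes bases -/

section Bases

variable {r N d : ℕ} {B : Matrix (Fin d) (Fin N) ℤ} {R : Matrix (Fin N) (Fin d) ℤ}
  {γ : Fin N → ℝ} {a : Fin N → Fin r → ℤ} {α : Fin r → ℝ}

/-- The germ of a function, as a linear map. -/
def germMap (υ : Fin N → ℂ) : ((Fin N → ℂ) → ℂ) →ₗ[ℂ] Germ (𝓝 υ) ℂ where
  toFun Φ := (Φ : Germ (𝓝 υ) ℂ)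
  map_add' _ _ := rfl
  map_smul' _ _ := rfl

/-- The points are `τ_i = (1/2π) ∑ θ_ij b_j`. Arguments of the same `υ` differ by multiples of `2π`,
so the differences are integral; equal points would make two basis elements proportional. -/
theorem HasMellinBarnesBasis.exists_zonotope {D : ℕ} (hd : 0 < d) (hR : B * R = 1)
    (hγ : ∀ j, γ j < 0) (h : HasMellinBarnesBasis a α γ B D) :
    ∃ τ : Fin D → Fin d → ℝ, Function.Injective τ ∧ (∀ i, τ i ∈ zonotope B) ∧
      ∀ i j k, ∃ n : ℤ, τ i k - τ j k = n := by
  obtain ⟨υ, hυ, M, hM⟩ := h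
  choose θ hθ hconv hgerm using hM
  set τ : Fin D → Fin d → ℝ := fun i k => (2 * Real.pi)⁻¹ * ∑ j, θ i j * (B k j : ℝ) with hτ
  have h2π : (2 * Real.pi) ≠ 0 := by positivity
  have hτ' : ∀ i k, ∑ j, θ i j * (B k j : ℝ) = 2 * Real.pi * τ i k := fun i k => by
    rw [hτ, mul_inv_cancel_left₀ h2π]
  choose n hn using fun i i' => exists_eq_add_two_pi hυ (hθ i') (hθ i)
  have hdiff : ∀ i i' k, τ i k - τ i' k = ∑ j, (n i i' j : ℝ) * (B k j : ℝ) := fun i i' k => by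
    have h1 : ∑ j, θ i j * (B k j : ℝ)
        = ∑ j, θ i' j * (B k j : ℝ) + 2 * Real.pi * ∑ j, (n i i' j : ℝ) * (B k j : ℝ) := by
      rw [Finset.mul_sum, ← Finset.sum_add_distrib]
      exact Finset.sum_congr rfl fun j _ => by rw [hn i i' j]; ring
    rw [hτ', hτ', ← mul_add] at h1
    linarith [mul_left_cancel₀ h2π h1]
  refine ⟨τ, fun i i' hii => ?_, fun i => mem_zonotope_of_eventually_mbConverges hd hR hγ hυ
    (hθ i) (hconv i) (hτ' i), fun i i' k => ⟨∑ j, n i i' j * B k j, ?_⟩⟩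
  · by_contra hne
    have h0 : ∀ k, ∑ j, (n i i' j : ℝ) * (B k j : ℝ) = 0 := fun k => by
      rw [← hdiff, hii, sub_self]
    have h1 := mbIntegral_add_two_pi_of_sum_eq_zero γ (θ i') h0
    have h2 : (fun j => θ i' j + 2 * Real.pi * n i i' j) = θ i := funext fun j => (hn i i' j).symm
    rw [h2] at h1
    set c := Complex.exp (2 * Real.pi * Complex.I * ((∑ j, γ j * n i i' j : ℝ) : ℂ))
    have h3 : M i = c • M i' := by
      apply Subtype.ext
      rw [Submodule.coe_smul, hgerm i, hgerm i', h1]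
      rfl
    have h4 := congrArg (fun x => M.repr x i) h3
    simp [Ne.symm hne] at h4
  · rw [hdiff]; push_cast; rfl

theorem arg_add_two_pi {υ : Fin N → ℂ} {θ : Fin N → ℝ}
    (hθ : ∀ j, υ j = (‖υ j‖ : ℂ) * Complex.exp (θ j * Complex.I)) (n : Fin N → ℤ) (j : Fin N) :
    υ j = (‖υ j‖ : ℂ) * Complex.exp (((θ j + 2 * Real.pi * n j : ℝ) : ℂ) * Complex.I) := by
  conv_lhs => rw [hθ j]
  congr 1
  rw [Complex.exp_eq_exp_iff_exists_int]
  exact ⟨-n j, by push_cast; ring⟩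

/-- The point `υ` lies in the domain given by arguments `θ` of its coordinates as soon as these
are admissible. -/
theorem mem_mbDomain_of_arg {υ : Fin N → ℂ} (hυ : ∀ j, υ j ≠ 0) {θ : Fin N → ℝ}
    (hθ : ∀ j, υ j = (‖υ j‖ : ℂ) * Complex.exp (θ j * Complex.I)) (h : Admissible B θ) :
    υ ∈ mbDomain B θ := by
  have hlog : logs θ υ = fun j => (Real.log ‖υ j‖ : ℂ) + θ j * Complex.I := by
    have := logs_eq_of_arg (θ := θ) (ψ := θ) (fun j => norm_pos_iff.2 (hυ j))
      fun j => by simpa using Real.pi_pos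
    rwa [← funext hθ] at this
  refine ⟨fun j => ?_, ?_⟩
  · rw [hθ j, mul_assoc, ← Complex.exp_add, add_neg_cancel, Complex.exp_zero, mul_one]
    exact Complex.ofReal_mem_slitPlane.2 (norm_pos_iff.2 (hυ j))
  · simpa [hlog] using h

theorem linearIndependent_germ_mbIntegral (hR : B * R = 1) (hγ : ∀ j, γ j < 0)
    {D : ℕ} {n : Fin D → Fin N → ℤ} {κ : Fin D → Fin d → ℤ} (hκ : Function.Injective κ)
    (hn : ∀ i k, ∑ j, (n i j : ℝ) * (B k j : ℝ) = κ i k) {υ : Fin N → ℂ} (hυ : ∀ j, υ j ≠ 0)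
    {θ : Fin N → ℝ} (hθ : ∀ j, υ j = (‖υ j‖ : ℂ) * Complex.exp (θ j * Complex.I))
    (hadm : ∀ i, Admissible B fun j => θ j + 2 * Real.pi * n i j) :
    LinearIndependent ℂ fun i =>
      germMap υ (mbIntegral γ B fun j => θ j + 2 * Real.pi * n i j) := by
  refine Fintype.linearIndependent_iff.2 fun c hc => ?_
  simp only [← map_smul, ← map_sum] at hc
  have hev := Germ.coe_eq.1 (show ((∑ i, c i • mbIntegral γ B fun j => θ j + 2 * Real.pi * n i j :
    (Fin N → ℂ) → ℂ) : Germ (𝓝 υ) ℂ) = ((0 : (Fin N → ℂ) → ℂ) : Germ (𝓝 υ) ℂ) from hc)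
  set w₀ : Fin N → ℂ := fun j => (Real.log ‖υ j‖ : ℂ) + θ j * Complex.I with hw₀
  have hexp : Tendsto (fun (w : Fin N → ℂ) j => Complex.exp (w j)) (𝓝 w₀) (𝓝 υ) := by
    refine Continuous.tendsto' (by fun_prop) _ _ (funext fun j => ?_)
    rw [hw₀, Complex.exp_add, ← Complex.ofReal_exp, Real.exp_log (norm_pos_iff.2 (hυ j)), ← hθ j]
  -- In this range the branch of the logarithm attached to `θ` inverts the exponential, so the
  -- relation between germs can be read in the variable `w`.
  have hnear : ∀ᶠ w in 𝓝 w₀, ∀ j, |(w j).im - θ j| < Real.pi := by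
    refine eventually_all.2 fun j => ?_
    have hcont : Continuous fun w : Fin N → ℂ => |(w j).im - θ j| :=
      ((Complex.continuous_im.comp (continuous_apply j)).sub continuous_const).abs
    refine hcont.continuousAt.eventually_lt_const ?_
    simpa [hw₀] using Real.pi_pos
  refine eq_zero_of_eventually_sum_mellinIntegral_eq_zero hR hγ hκ hn (w₀ := w₀) (fun i => ?_) ?_
  · simpa [hw₀, twoPiI_im] using hadm i
  · filter_upwards [hexp.eventually hev, hnear] with w hw hwn
    have hlog : logs θ (fun j => Complex.exp (w j)) = w := by
      have h1 := logs_eq_of_arg (θ := θ) (ψ := fun j => (w j).im)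
        (fun j => Real.exp_pos (w j).re) hwn
      have h2 : (fun j => ((Real.exp (w j).re : ℝ) : ℂ) * Complex.exp ((w j).im * Complex.I))
          = fun j => Complex.exp (w j) := funext fun j => by
        rw [Complex.ofReal_exp, ← Complex.exp_add, Complex.re_add_im]
      rw [h2] at h1
      rw [h1]
      ext j
      rw [Real.log_exp, Complex.re_add_im]
    simp only [Finset.sum_apply, Pi.smul_apply, mbIntegral_eq, logs_add_two_pi, hlog, smul_eq_mul,
      Pi.zero_apply, mul_left_comm (c _)] at hw
    rw [← Finset.mul_sum] at hw
    exact (mul_eq_zero.1 hw).resolve_left (pow_ne_zero _ Complex.I_ne_zero)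

/-- Lifting the `τ_i` through the right inverse gives arguments differing by `2πn_i` with `n_i`
integral, hence `D` determinations at one point. Their independence and the rank make them a basis.
-/
theorem hasMellinBarnesBasis_of_zonotope (ha : IsASet a) (hB : IsBMatrix a B) (hR : B * R = 1)
    (hγ : ∀ j, γ j < 0) (hγα : ∑ j, γ j • toReal (a j) = α) {D : ℕ} (hD : HasRank a α D)
    {τ : Fin D → Fin d → ℝ} (hτ : Function.Injective τ) (hτZ : ∀ i, τ i ∈ zonotope B)
    (hτn : ∀ i j k, ∃ n : ℤ, τ i k - τ j k = n) : HasMellinBarnesBasis a α γ B D := by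
  obtain ⟨τ₀, κ, hτκ⟩ : ∃ (τ₀ : Fin d → ℝ) (κ : Fin D → Fin d → ℤ), ∀ i k,
      τ i k = τ₀ k + κ i k := by
    rcases Nat.eq_zero_or_pos D with rfl | hD0
    · exact ⟨0, 0, fun i => i.elim0⟩
    · choose κ hκ using fun i k => hτn i ⟨0, hD0⟩ k
      exact ⟨τ ⟨0, hD0⟩, κ, fun i k => by rw [← hκ]; ring⟩
  have hκ : Function.Injective κ := fun i j hij => hτ (funext fun k => by rw [hτκ, hτκ, hij])
  have hBR : ∀ k k', ∑ j, B k j * R j k' = if k = k' then 1 else 0 := fun k k' => by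
    have := congrFun (congrFun hR k) k'
    rwa [Matrix.mul_apply, Matrix.one_apply] at this
  have hBx : ∀ (x : Fin d → ℝ) k, ∑ j, (∑ k', (R j k' : ℝ) * x k') * (B k j : ℝ) = x k := by
    intro x k
    have h2 : ∑ j, (∑ k', (R j k' : ℝ) * x k') * (B k j : ℝ)
        = ∑ k', ((∑ j, B k j * R j k' : ℤ) : ℝ) * x k' := by
      push_cast
      simp only [Finset.sum_mul]
      rw [Finset.sum_comm]
      exact Finset.sum_congr rfl fun _ _ => Finset.sum_congr rfl fun _ _ => by ring
    rw [h2]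
    simp [hBR]
  set n : Fin D → Fin N → ℤ := fun i j => ∑ k, R j k * κ i k with hn
  have hnB : ∀ i k, ∑ j, (n i j : ℝ) * (B k j : ℝ) = κ i k := fun i k => by
    rw [← hBx (fun k => (κ i k : ℝ)) k]
    simp [hn]
  set θ₀ : Fin N → ℝ := fun j => 2 * Real.pi * ∑ k, (R j k : ℝ) * τ₀ k with hθ₀
  have hθB : ∀ k, ∑ j, θ₀ j * (B k j : ℝ) = 2 * Real.pi * τ₀ k := fun k => by
    simp only [hθ₀, mul_assoc (2 * Real.pi), ← Finset.mul_sum]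
    rw [hBx]
  have hadm₀ : ∀ i, Admissible B fun j => θ₀ j + 2 * Real.pi * n i j := fun i => by
    refine admissible_of_mem_zonotope (hτZ i) fun k => ?_
    simp only [add_mul, Finset.sum_add_distrib, hθB, mul_assoc (2 * Real.pi), ← Finset.mul_sum, hnB]
    rw [hτκ]; ring
  set v₀ : Fin N → ℂ := fun j => Complex.exp (θ₀ j * Complex.I) with hv₀
  have hv₀θ : ∀ j, v₀ j = (‖v₀ j‖ : ℂ) * Complex.exp (θ₀ j * Complex.I) := fun j => by
    simp [hv₀, Complex.norm_exp_ofReal_mul_I]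
  have hv₀ne : ∀ j, v₀ j ≠ 0 := fun j => Complex.exp_ne_zero _
  -- The first point `v₀` need not be generic. All integrals converge on an open set around it,
  -- which meets the dense set where the rank is attained.
  set W : Set (Fin N → ℂ) :=
    {v | ∀ j, v j * Complex.exp (-(θ₀ j * Complex.I)) ∈ Complex.slitPlane} ∩
      ⋂ i, mbDomain B fun j => θ₀ j + 2 * Real.pi * n i j with hW
  have hWo : IsOpen W := by
    refine IsOpen.inter ?_ (isOpen_iInter_of_finite fun i => isOpen_mbDomain)
    simp only [Set.ofPred_forall]
    exact isOpen_iInter_of_finite fun j => Complex.isOpen_slitPlane.preimage (by fun_prop)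
  have hWne : W.Nonempty := by
    refine ⟨v₀, fun j => ?_, Set.mem_iInter.2 fun i =>
      mem_mbDomain_of_arg hv₀ne (arg_add_two_pi hv₀θ (n i)) (hadm₀ i)⟩
    rw [hv₀, ← Complex.exp_add, add_neg_cancel, Complex.exp_zero]
    exact Complex.one_mem_slitPlane
  obtain ⟨U, -, hUd, hrank⟩ := hD
  obtain ⟨υ, ⟨hυ₀, hυi⟩, hυU⟩ := hUd.inter_open_nonempty W hWo hWne
  have hυne : ∀ j, υ j ≠ 0 := fun j h => by
    have := hυ₀ j
    rw [h, zero_mul] at this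
    exact Complex.zero_notMem_slitPlane this
  -- The arguments are read off again at the generic point; the shifts `2πn_i` are unchanged.
  set θ : Fin N → ℝ := fun j => (logs θ₀ υ j).im with hθ
  have hre : ∀ j, (logs θ₀ υ j).re = Real.log ‖υ j‖ := fun j => by
    have h1 := congrArg norm (exp_branchLog (θ₀ j) (hυne j))
    rw [Complex.norm_exp] at h1
    rw [← h1, Real.log_exp, logs]
  have hυθ : ∀ j, υ j = (‖υ j‖ : ℂ) * Complex.exp (θ j * Complex.I) := fun j => by
    have h1 := exp_branchLog (θ₀ j) (hυne j)
    rw [← Complex.re_add_im (branchLog (θ₀ j) (υ j)), Complex.exp_add] at h1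
    have h2 := hre j
    rw [logs] at h2
    rw [h2, ← Complex.ofReal_exp, Real.exp_log (norm_pos_iff.2 (hυne j))] at h1
    exact h1.symm
  have hadm : ∀ i, Admissible B fun j => θ j + 2 * Real.pi * n i j := fun i => by
    have h1 := (Set.mem_iInter.1 hυi i).2
    rw [logs_add_two_pi] at h1
    simpa only [Pi.add_apply, Complex.add_im, twoPiI_im] using h1
  have hdom : ∀ i, ∀ᶠ v in 𝓝 υ, v ∈ mbDomain B fun j => θ j + 2 * Real.pi * n i j := fun i =>
    isOpen_mbDomain.mem_nhds (mem_mbDomain_of_arg hυne (arg_add_two_pi hυθ (n i)) (hadm i))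
  set b : Fin D → localSolutions a α υ := fun i =>
    ⟨germMap υ (mbIntegral γ B fun j => θ j + 2 * Real.pi * n i j), _, rfl, by
      filter_upwards [hdom i] with v hv using solvesAt_mbIntegral ha hB hR hγ hγα hv⟩ with hb
  have hli : LinearIndependent ℂ b := by
    refine LinearIndependent.of_comp (localSolutions a α υ).subtype ?_
    exact linearIndependent_germ_mbIntegral hR hγ hκ hnB hυne hυθ hadm
  have hr := hrank υ hυU
  have hfin : FiniteDimensional ℂ (localSolutions a α υ) := Module.finite_of_rank_eq_nat hr
  have hspan := hli.span_eq_top_of_card_eq_finrank' (by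
    rw [Fintype.card_fin, Module.finrank_eq_of_rank_eq hr])
  refine ⟨υ, hυne, Module.Basis.mk hli hspan.ge, fun i => ⟨_, arg_add_two_pi hυθ (n i), ?_, ?_⟩⟩
  · filter_upwards [hdom i] with v hv using mbConverges_of_mem hR hγ hv
  · rw [Module.Basis.mk_apply]
    rfl

end Bases

end AHypergeometric

end

/-! ### The equivalence -/

open AHypergeometric in
theorem proposition2 {r d N : ℕ} (hd : 0 < d) (hN : N = r + d)
    (a : Fin N → Fin r → ℤ) (ha : IsASet a)
    (α : Fin r → ℝ) (hα : TotallyNonResonant a α)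
    (B : Matrix (Fin d) (Fin N) ℤ) (hB : IsBMatrix a B)
    (γ : Fin N → ℝ) (hγ : ∀ j, γ j < 0) (hγα : ∑ j, γ j • toReal (a j) = α)
    (D : ℕ) (hD : HasRank a α D) :
    HasMellinBarnesBasis a α γ B D ↔
      ∃ τ : Fin D → Fin d → ℝ, Function.Injective τ ∧ (∀ i, τ i ∈ zonotope B) ∧
        ∀ i j k, ∃ n : ℤ, τ i k - τ j k = n := by
  obtain ⟨R, hR⟩ := hB.exists_mul_eq_one ha
  refine ⟨fun h => h.exists_zonotope hd hR hγ, ?_⟩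
  rintro ⟨τ, hτ, hτZ, hτn⟩
  exact hasMellinBarnesBasis_of_zonotope ha hB hR hγ hγα hD hτ hτZ hτn
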